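/- Let $\mathbb D$ be the open unit disk in $\mathbb C$, let $-1<\alpha\le 0$, and let $\varphi$ be an analytic function on $\mathbb D$ with $|\varphi(z)|\le 1$ for all $z\in\mathbb D$. Let $A^2_\alpha$ be the weighted Bergman space of all analytic functions in $L^2(\mathbb D,dA_\alpha)$, where $dA_\alpha(z)=\frac{\alpha+1}{\pi}(1-|z|^2)^\alpha\,dx\,dy$, with the inner product of $L^2(\mathbb D,dA_\alpha)$; let $T_\varphi:A^2_\alpha\to A^2_\alpha$, $T_\varphi f=\varphi f$, and let $H^\alpha(\varphi)$ be the sub-Bergman space, that is, the range of the defect operator $D=(I-T_\varphi T_\varphi^*)^{1/2}$ with the inner product $\langle Dx,Dy\rangle_{H^\alpha(\varphi)}=\langle x,y\rangle_{A^2_\alpha}$ for $x,y\in A^2_\alpha\ominus\ker D$. A kernel function $K$ on a set $\Omega$ (positive semidefinite on every finite set of points) is called irreducible if $K(z,w)\neq 0$ for all $z,w\in\Omega$ and the functions $K(\cdot,z)$, $K(\cdot,w)$ are linearly independent whenever $z\ne w$. An irreducible kernel function $K$ on $\Omega$ is called a complete Nevanlinna--Pick kernel if there are a Hilbert space $\mathcal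 L$, a function $b:\Omega\to\mathcal L$ and a nowhere vanishing function $\delta:\Omega\to\mathbb C$ such that $K(z,w)=\dfrac{\delta(z)\overline{\delta(w)}}{1-\langle b(z),b(w)\rangle}$ for all $z,w\in\Omega$, where the denominators do not vanish. Then the reproducing kernel of $H^\alpha(\varphi)$ is $$K^{\alpha,\varphi}(z,w)=\frac{1-\varphi(z)\overline{\varphi(w)}}{(1-z\overline w)^{2+\alpha}},\qquad z,w\in\mathbb D$$ (principal branch of the power), and it is a complete Nevanlinna--Pick kernel if and only if $\varphi$ is a Möbius map of the disk, that is, $\varphi(z)=\zeta\,\dfrac{a-z}{1-\overline a z}$ on $\mathbb D$ for some $\zeta,a\in\mathbb C$ with $|\zeta|=1$ and $|a|<1$. (For $\alpha=0$, this is the case of the ordinary Bergman space.) -/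

import Mathlib

open MeasureTheory Metric Complex Filter Topology
open scoped ComplexConjugate ComplexOrder InnerProductSpace UnitDisc ENNReal

universe u

noncomputable section

/-! ### Weighted Bergman spaces -/

/-- The weight `(α + 1) / π * (1 - |z|²) ^ α` of the normalized measure `dA_α` on the disk. -/
def bergmanWeight (α : ℝ) (z : ℂ) : ℝ≥0∞ :=
  ENNReal.ofReal ((α + 1) / Real.pi * (1 - ‖z‖ ^ 2) ^ α)

/-- The probability measure `dA_α(z) = (α + 1) (1 - |z|²) ^ α dA(z)` on the unit disk (`α > -1`),
where `dA` is the normalized area measure; it is regarded as a measure on `ℂ`. -/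
def bergmanMeasure (α : ℝ) : Measure ℂ :=
  (volume.restrict (ball (0 : ℂ) 1)).withDensity (bergmanWeight α)

/-- The weighted Bergman space `A²_α`, `α > -1`: the (classes of) functions in `L²(𝔻, dA_α)` that
are analytic on the unit disk, with the inner product of `L²(𝔻, dA_α)`. -/
def Bergman (α : ℝ) (_hα : -1 < α) : Submodule ℂ (Lp ℂ 2 (bergmanMeasure α)) where
  carrier := {f | ∃ g : ℂ → ℂ, DifferentiableOn ℂ g (ball 0 1) ∧ f =ᵐ[bergmanMeasure α] g}
  zero_mem' := ⟨0, differentiableOn_const 0, Lp.coeFn_zero _ _ _⟩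
  add_mem' := by
    rintro f₁ f₂ ⟨g₁, h₁, e₁⟩ ⟨g₂, h₂, e₂⟩
    exact ⟨g₁ + g₂, h₁.add h₂, (Lp.coeFn_add f₁ f₂).trans (e₁.add e₂)⟩
  smul_mem' := by
    rintro c f ⟨g, h, e⟩
    exact ⟨c • g, h.const_smul c, (Lp.coeFn_smul c f).trans (e.const_smul c)⟩

theorem measurable_bergmanWeight (α : ℝ) : Measurable (bergmanWeight α) := by
  unfold bergmanWeight; fun_prop

theorem bergmanWeight_pos {α : ℝ} (hα : -1 < α) {z : ℂ} (hz : z ∈ ball (0 : ℂ) 1) :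
    bergmanWeight α z ≠ 0 := by
  have h1 : ‖z‖ < 1 := by simpa using hz
  have h2 : 0 < 1 - ‖z‖ ^ 2 := by nlinarith [norm_nonneg z]
  have h3 : 0 < α + 1 := by linarith
  have : 0 < (α + 1) / Real.pi * (1 - ‖z‖ ^ 2) ^ α := by positivity
  simpa [bergmanWeight] using this

theorem bergmanMeasure_ac (α : ℝ) :
    bergmanMeasure α ≪ volume.restrict (ball (0 : ℂ) 1) :=
  withDensity_absolutelyContinuous _ _

theorem ac_bergmanMeasure {α : ℝ} (hα : -1 < α) :
    volume.restrict (ball (0 : ℂ) 1) ≪ bergmanMeasure α := by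
  refine withDensity_absolutelyContinuous' (measurable_bergmanWeight α).aemeasurable ?_
  filter_upwards [ae_restrict_mem measurableSet_ball] with z hz using bergmanWeight_pos hα hz

theorem ae_mem_ball_bergmanMeasure (α : ℝ) : ∀ᵐ z ∂(bergmanMeasure α), z ∈ ball (0 : ℂ) 1 :=
  (bergmanMeasure_ac α) (ae_restrict_mem measurableSet_ball)

theorem aestronglyMeasurable_bergmanMeasure (α : ℝ) {g : ℂ → ℂ}
    (hg : DifferentiableOn ℂ g (ball 0 1)) : AEStronglyMeasurable g (bergmanMeasure α) :=
  (hg.continuousOn.aestronglyMeasurable measurableSet_ball).mono_ac (bergmanMeasure_ac α)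

namespace Bergman

variable {α : ℝ} {hα : -1 < α}

/-- The analytic representative of an element of the Bergman space. -/
def rep (f : Bergman α hα) : ℂ → ℂ := f.2.choose

theorem differentiableOn_rep (f : Bergman α hα) : DifferentiableOn ℂ (rep f) (ball 0 1) :=
  f.2.choose_spec.1

theorem coe_ae_eq_rep (f : Bergman α hα) :
    ((f : Lp ℂ 2 (bergmanMeasure α)) : ℂ → ℂ) =ᵐ[bergmanMeasure α] rep f :=
  f.2.choose_spec.2

/-- The analytic representative is unique on the disk. -/
theorem rep_eqOn (f : Bergman α hα) {g : ℂ → ℂ} (hg : DifferentiableOn ℂ g (ball 0 1))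
    (h : ((f : Lp ℂ 2 (bergmanMeasure α)) : ℂ → ℂ) =ᵐ[bergmanMeasure α] g) :
    Set.EqOn (rep f) g (ball 0 1) :=
  Measure.eqOn_open_of_ae_eq (μ := volume)
    ((ac_bergmanMeasure hα).ae_eq ((coe_ae_eq_rep f).symm.trans h)) isOpen_ball
    (differentiableOn_rep f).continuousOn hg.continuousOn

end Bergman

/-- The sub-mean value property over disks. -/
theorem enorm_le_lintegral_ball {h : ℂ → ℂ} {c : ℂ} {δ : ℝ} (hδ : 0 < δ)
    (hh : DifferentiableOn ℂ h (ball c δ)) :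
    ENNReal.ofReal (Real.pi * δ ^ 2) * ‖h c‖ₑ ≤ ∫⁻ z in ball c δ, ‖h z‖ₑ := by
  set F : ℂ → ℂ := (ball c δ).indicator h with hF
  have hFm : Measurable F := by
    classical
    have := ContinuousOn.measurable_piecewise (s := ball c δ) (f := h) (g := 0)
      hh.continuousOn continuousOn_const measurableSet_ball
    rwa [Set.piecewise_eq_indicator] at this
  have h1 : ∫⁻ z in ball c δ, ‖h z‖ₑ = ∫⁻ u, ‖F (c + u)‖ₑ := by
    rw [lintegral_add_left_eq_self (fun z => ‖F z‖ₑ) c, ← lintegral_indicator measurableSet_ball]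
    refine lintegral_congr fun z => ?_
    by_cases hz : z ∈ ball c δ <;> simp [hF, hz]
  have h2 : ∀ r ∈ Set.Ioo 0 δ, ENNReal.ofReal (2 * Real.pi) * ‖h c‖ₑ ≤
      ∫⁻ θ in Set.Ioo (-Real.pi) Real.pi, ‖F (c + Complex.polarCoord.symm (r, θ))‖ₑ := by
    intro r hr
    have hsub : closedBall c r ⊆ ball c δ := closedBall_subset_ball hr.2
    have hd : DiffContOnCl ℂ h (ball c |r|) := by
      rw [abs_of_pos hr.1]
      exact (hh.mono hsub).diffContOnCl_ball subset_rfl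
    have havg := hd.circleAverage
    have hper : ∫ θ in (0 : ℝ)..(2 * Real.pi), h (circleMap c r θ) =
        ∫ θ in (-Real.pi)..Real.pi, h (circleMap c r θ) := by
      have := ((periodic_circleMap c r).comp h).intervalIntegral_add_eq 0 (-Real.pi)
      simp only [Function.comp_apply, zero_add] at this
      rw [this]; congr 1; ring
    rw [Real.circleAverage, hper, intervalIntegral.integral_of_le (by linarith [Real.pi_pos]),
      integral_Ioc_eq_integral_Ioo] at havg
    have h3 : ((2 * Real.pi : ℝ) : ℂ) * h c =
        ∫ θ in Set.Ioo (-Real.pi) Real.pi, h (circleMap c r θ) := by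
      rw [← havg, Complex.real_smul, ← mul_assoc, ← Complex.ofReal_mul,
        mul_inv_cancel₀ (by positivity), Complex.ofReal_one, one_mul]
    have h4 : ENNReal.ofReal (2 * Real.pi) * ‖h c‖ₑ =
        ‖∫ θ in Set.Ioo (-Real.pi) Real.pi, h (circleMap c r θ)‖ₑ := by
      rw [← h3, enorm_mul]
      congr 1
      rw [← ofReal_norm, Complex.norm_real, Real.norm_of_nonneg (by positivity)]
    rw [h4]
    refine (enorm_integral_le_lintegral_enorm _).trans (le_of_eq ?_)
    refine lintegral_congr fun θ => ?_
    have e : c + Complex.polarCoord.symm (r, θ) = circleMap c r θ := by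
      rw [Complex.polarCoord_symm_apply, circleMap, Complex.exp_mul_I]
      push_cast; rfl
    have hm : circleMap c r θ ∈ ball c δ := hsub (circleMap_mem_closedBall c hr.1.le θ)
    rw [e, hF, Set.indicator_of_mem hm]
  have hGm : Measurable (fun p : ℝ × ℝ =>
      ENNReal.ofReal p.1 * ‖F (c + Complex.polarCoord.symm p)‖ₑ) := by
    have : Continuous (fun p : ℝ × ℝ => c + Complex.polarCoord.symm p) := by
      simp only [Complex.polarCoord_symm_apply]; fun_prop
    exact (by fun_prop : Measurable fun p : ℝ × ℝ => ENNReal.ofReal p.1).mul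
      (hFm.comp this.measurable).enorm
  have h5 : ∫⁻ r in Set.Ioo 0 δ, ENNReal.ofReal r = ENNReal.ofReal (δ ^ 2 / 2) := by
    rw [← ofReal_integral_eq_lintegral_ofReal]
    · rw [← integral_Ioc_eq_integral_Ioo, ← intervalIntegral.integral_of_le hδ.le, integral_id]
      congr 1; ring
    · exact (continuous_id.integrableOn_Icc (a := 0) (b := δ)).mono_set Set.Ioo_subset_Icc_self
    · filter_upwards [ae_restrict_mem measurableSet_Ioo] with r hr using hr.1.le
  rw [h1, ← Complex.lintegral_comp_polarCoord_symm, polarCoord_target, Measure.volume_eq_prod,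
    ← Measure.prod_restrict]
  simp only [smul_eq_mul]
  rw [lintegral_prod _ hGm.aemeasurable]
  calc ENNReal.ofReal (Real.pi * δ ^ 2) * ‖h c‖ₑ
      = ∫⁻ r in Set.Ioo 0 δ, ENNReal.ofReal r * (ENNReal.ofReal (2 * Real.pi) * ‖h c‖ₑ) := by
        rw [lintegral_mul_const _ (by fun_prop), h5, ← mul_assoc,
          ← ENNReal.ofReal_mul (by positivity)]
        congr 2; ring
    _ ≤ ∫⁻ r in Set.Ioo 0 δ, ∫⁻ θ in Set.Ioo (-Real.pi) Real.pi,
          ENNReal.ofReal r * ‖F (c + Complex.polarCoord.symm (r, θ))‖ₑ := by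
        refine setLIntegral_mono' measurableSet_Ioo fun r hr => ?_
        rw [lintegral_const_mul' _ _ ENNReal.ofReal_ne_top]
        gcongr
        exact h2 r hr
    _ ≤ _ := lintegral_mono_set Set.Ioo_subset_Ioi_self

/-- Point evaluations on the disk are bounded in the Bergman norm, locally uniformly. -/
theorem exists_enorm_le {α : ℝ} (hα : -1 < α) {r : ℝ} (hr : r < 1) :
    ∃ C : ℝ, 0 ≤ C ∧ ∀ g : ℂ → ℂ, DifferentiableOn ℂ g (ball 0 1) →
      ∀ z ∈ closedBall (0 : ℂ) r, ‖g z‖ₑ ≤ ENNReal.ofReal C * eLpNorm g 2 (bergmanMeasure α) := by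
  rcases lt_or_ge r 0 with hr0 | hr0
  · exact ⟨0, le_rfl, fun g _ z hz => by simp [closedBall_eq_empty.2 hr0] at hz⟩
  set δ := (1 - r) / 2 with hδ
  set ρ := r + δ with hρ
  have hδ0 : 0 < δ := by rw [hδ]; linarith
  have hρ1 : ρ < 1 := by rw [hρ, hδ]; linarith
  have hρ0 : 0 ≤ ρ := by rw [hρ]; linarith
  have hρ2 : 0 < 1 - ρ ^ 2 := by nlinarith
  have hα1 : 0 < α + 1 := by linarith
  set m := (α + 1) / Real.pi * (1 - ρ ^ 2) ^ |α| with hm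
  have hm0 : 0 < m := by positivity
  have hw : ∀ z ∈ ball (0 : ℂ) ρ, ENNReal.ofReal m ≤ bergmanWeight α z := by
    intro z hz
    have hz' : ‖z‖ < ρ := by simpa using hz
    have h1 : 1 - ρ ^ 2 ≤ 1 - ‖z‖ ^ 2 := by nlinarith [norm_nonneg z]
    refine ENNReal.ofReal_le_ofReal ?_
    rw [hm]
    refine mul_le_mul_of_nonneg_left ?_ (by positivity)
    calc (1 - ρ ^ 2) ^ |α| ≤ (1 - ‖z‖ ^ 2) ^ |α| := by gcongr
      _ ≤ (1 - ‖z‖ ^ 2) ^ α :=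
        Real.rpow_le_rpow_of_exponent_ge (by linarith) (by nlinarith [norm_nonneg z]) (le_abs_self α)
  set k := √(Real.pi * δ ^ 2 * m) with hk
  have hk0 : 0 < k := by positivity
  refine ⟨k⁻¹, by positivity, fun g hg z hz => ?_⟩
  have hz' : ‖z‖ ≤ r := by simpa using hz
  have hball : ball z δ ⊆ ball 0 ρ := by
    refine ball_subset_ball' ?_
    rw [dist_zero_right, hρ]; linarith
  have hball1 : ball (0 : ℂ) ρ ⊆ ball 0 1 := ball_subset_ball hρ1.le
  have hg2 : DifferentiableOn ℂ (fun z => g z ^ 2) (ball z δ) :=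
    (hg.mono (hball.trans hball1)).pow 2
  have h1 := enorm_le_lintegral_ball hδ0 hg2
  have h2 : ENNReal.ofReal m * ∫⁻ u in ball z δ, ‖g u ^ 2‖ₑ ≤
      eLpNorm g 2 (bergmanMeasure α) ^ 2 := by
    rw [← lintegral_const_mul' _ _ ENNReal.ofReal_ne_top]
    have e : eLpNorm g 2 (bergmanMeasure α) ^ 2 = ∫⁻ u, ‖g u ^ 2‖ₑ ∂(bergmanMeasure α) := by
      rw [eLpNorm_eq_lintegral_rpow_enorm_toReal (by simp) (by simp), ← ENNReal.rpow_natCast,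
        ← ENNReal.rpow_mul]
      simp [enorm_pow]
    have hae : AEMeasurable (fun u => ‖g u ^ 2‖ₑ) (volume.restrict (ball (0 : ℂ) 1)) :=
      ((hg.continuousOn.aestronglyMeasurable measurableSet_ball).pow 2).enorm
    rw [e, bergmanMeasure, lintegral_withDensity_eq_lintegral_mul₀
      (measurable_bergmanWeight α).aemeasurable hae]
    refine le_trans ?_ (lintegral_mono_set (hball.trans hball1))
    refine setLIntegral_mono' measurableSet_ball fun u hu => ?_
    simp only [Pi.mul_apply]
    gcongr
    exact hw u (hball hu)
  have h3 : (ENNReal.ofReal k * ‖g z‖ₑ) ^ 2 ≤ eLpNorm g 2 (bergmanMeasure α) ^ 2 := by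
    calc (ENNReal.ofReal k * ‖g z‖ₑ) ^ 2
        = ENNReal.ofReal m * (ENNReal.ofReal (Real.pi * δ ^ 2) * ‖g z ^ 2‖ₑ) := by
          have hkk : k ^ 2 = m * (Real.pi * δ ^ 2) := by
            rw [hk, Real.sq_sqrt (by positivity), mul_comm]
          rw [mul_pow, ← ENNReal.ofReal_pow hk0.le, hkk, enorm_pow,
            ENNReal.ofReal_mul hm0.le, mul_assoc]
      _ ≤ _ := (mul_le_mul_right h1 _).trans h2
  have h4 : ENNReal.ofReal k * ‖g z‖ₑ ≤ eLpNorm g 2 (bergmanMeasure α) :=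
    (ENNReal.pow_le_pow_left_iff two_ne_zero).1 h3
  calc ‖g z‖ₑ = ENNReal.ofReal k⁻¹ * (ENNReal.ofReal k * ‖g z‖ₑ) := by
        rw [← mul_assoc, ← ENNReal.ofReal_mul (by positivity), inv_mul_cancel₀ hk0.ne']; simp
    _ ≤ _ := by gcongr

namespace Bergman

variable {α : ℝ} {hα : -1 < α}

theorem exists_norm_rep_le (hα : -1 < α) {r : ℝ} (hr : r < 1) :
    ∃ C : ℝ, 0 ≤ C ∧ ∀ f : Bergman α hα, ∀ z ∈ closedBall (0 : ℂ) r, ‖rep f z‖ ≤ C * ‖f‖ := by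
  obtain ⟨C, hC, H⟩ := exists_enorm_le hα hr
  refine ⟨C, hC, fun f z hz => ?_⟩
  have h1 := H (rep f) (differentiableOn_rep f) z hz
  rw [← eLpNorm_congr_ae (coe_ae_eq_rep f)] at h1
  have h2 := ENNReal.toReal_mono
    (ENNReal.mul_ne_top ENNReal.ofReal_ne_top (Lp.eLpNorm_ne_top (f : Lp ℂ 2 (bergmanMeasure α)))) h1
  rw [ENNReal.toReal_mul, ENNReal.toReal_ofReal hC, ← Lp.norm_def] at h2
  simpa using h2

theorem rep_add (f g : Bergman α hα) : Set.EqOn (rep (f + g)) (rep f + rep g) (ball 0 1) :=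
  rep_eqOn _ ((differentiableOn_rep f).add (differentiableOn_rep g))
    ((Lp.coeFn_add (f : Lp ℂ 2 (bergmanMeasure α)) g).trans
      ((coe_ae_eq_rep f).add (coe_ae_eq_rep g)))

theorem rep_smul (c : ℂ) (f : Bergman α hα) : Set.EqOn (rep (c • f)) (c • rep f) (ball 0 1) :=
  rep_eqOn _ ((differentiableOn_rep f).const_smul c)
    ((Lp.coeFn_smul c (f : Lp ℂ 2 (bergmanMeasure α))).trans ((coe_ae_eq_rep f).const_smul c))

theorem rep_sub (f g : Bergman α hα) : Set.EqOn (rep (f - g)) (rep f - rep g) (ball 0 1) :=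
  rep_eqOn _ ((differentiableOn_rep f).sub (differentiableOn_rep g))
    ((Lp.coeFn_sub (f : Lp ℂ 2 (bergmanMeasure α)) g).trans
      ((coe_ae_eq_rep f).sub (coe_ae_eq_rep g)))

theorem mem_ball (z : 𝔻) : (z : ℂ) ∈ ball (0 : ℂ) 1 := by simpa using z.norm_lt_one

theorem isClosed_bergman (α : ℝ) (hα : -1 < α) :
    IsClosed (Bergman α hα : Set (Lp ℂ 2 (bergmanMeasure α))) := by
  refine IsSeqClosed.isClosed ?_
  intro F f hF hlim
  let G : ℕ → Bergman α hα := fun n => ⟨F n, hF n⟩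
  have hcF : CauchySeq F := hlim.cauchySeq
  have key : ∀ r < 1, ∀ ε > 0, ∃ N, ∀ m ≥ N, ∀ n ≥ N, ∀ z ∈ closedBall (0 : ℂ) r,
      ‖rep (G m) z - rep (G n) z‖ < ε := by
    intro r hr ε hε
    obtain ⟨C, hC, H⟩ := exists_norm_rep_le hα hr
    obtain ⟨N, hN⟩ := Metric.cauchySeq_iff.1 hcF (ε / (C + 1)) (by positivity)
    refine ⟨N, fun m hm n hn z hz => ?_⟩
    have h1 := H (G m - G n) z hz
    rw [rep_sub (G m) (G n) (closedBall_subset_ball hr hz)] at h1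
    have h2 : ‖G m - G n‖ < ε / (C + 1) := by
      have := hN m hm n hn
      rwa [dist_eq_norm] at this
    calc ‖rep (G m) z - rep (G n) z‖ ≤ C * ‖G m - G n‖ := h1
      _ ≤ (C + 1) * ‖G m - G n‖ := by gcongr; linarith
      _ < (C + 1) * (ε / (C + 1)) := by gcongr
      _ = ε := by field_simp
  have hlimex : ∀ z ∈ ball (0 : ℂ) 1, ∃ l, Tendsto (fun n => rep (G n) z) atTop (𝓝 l) := by
    intro z hz
    refine cauchySeq_tendsto_of_complete (Metric.cauchySeq_iff.2 fun ε hε => ?_)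
    obtain ⟨N, hN⟩ := key ‖z‖ (by simpa using hz) ε hε
    exact ⟨N, fun m hm n hn => by rw [dist_eq_norm]; exact hN m hm n hn z (by simp)⟩
  choose! g hg using hlimex
  have hloc : TendstoLocallyUniformlyOn (fun n => rep (G n)) g atTop (ball 0 1) := by
    rw [tendstoLocallyUniformlyOn_iff_forall_isCompact isOpen_ball]
    intro K hK hKc
    obtain ⟨r, hr, hKr⟩ : ∃ r < 1, K ⊆ closedBall (0 : ℂ) r := by
      obtain ⟨r, hr, hKr⟩ := exists_lt_subset_ball hKc.isClosed hK
      exact ⟨r, hr, hKr.trans ball_subset_closedBall⟩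
    rw [Metric.tendstoUniformlyOn_iff]
    intro ε hε
    obtain ⟨N, hN⟩ := key r hr (ε / 2) (by positivity)
    filter_upwards [eventually_ge_atTop N] with n hn z hz
    have hz1 := hg z (hK hz)
    rw [dist_eq_norm]
    refine lt_of_le_of_lt (b := ε / 2) ?_ (by linarith)
    refine le_of_tendsto ((hz1.sub_const (rep (G n) z)).norm) ?_
    filter_upwards [eventually_ge_atTop N] with m hm using (hN m hm n hn z (hKr hz)).le
  refine ⟨g, hloc.differentiableOn (Eventually.of_forall fun n => differentiableOn_rep (G n))
    isOpen_ball, ?_⟩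
  obtain ⟨ns, hns, hae⟩ := (tendstoInMeasure_of_tendsto_Lp hlim).exists_seq_tendsto_ae
  have hrep : ∀ᵐ z ∂(bergmanMeasure α), ∀ n, F n z = rep (G n) z :=
    ae_all_iff.2 fun n => coe_ae_eq_rep (G n)
  filter_upwards [hae, hrep, ae_mem_ball_bergmanMeasure α] with z h1 h2 h3
  refine tendsto_nhds_unique h1 ?_
  simp only [h2]
  exact (hg z h3).comp hns.tendsto_atTop

instance instCompleteSpace : CompleteSpace (Bergman α hα) :=
  (isClosed_bergman α hα).completeSpace_coe

/-- Evaluation at a point of the disk, as a bounded functional on the Bergman space. -/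
def evalCLM (α : ℝ) (hα : -1 < α) (z : 𝔻) : Bergman α hα →L[ℂ] ℂ :=
  LinearMap.mkContinuousOfExistsBound
    { toFun := fun f => rep f z
      map_add' := fun f g => rep_add f g (mem_ball z)
      map_smul' := fun c f => rep_smul c f (mem_ball z) }
    (by
      obtain ⟨C, -, h⟩ := exists_norm_rep_le hα z.norm_lt_one
      exact ⟨C, fun f => h f z (by simp)⟩)

/-- The Bergman space as a Hilbert space of functions on the unit disk. -/
instance instRKHS : RKHS ℂ (Bergman α hα) 𝔻 ℂ where
  coeCLM := ContinuousLinearMap.pi (evalCLM α hα)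
  coeCLM_injective := by
    intro f g hfg
    have h : ∀ z ∈ ball (0 : ℂ) 1, rep f z = rep g z := fun z hz =>
      congrFun hfg (UnitDisc.mk z (by simpa using hz))
    refine Subtype.ext (Lp.ext ?_)
    refine (coe_ae_eq_rep f).trans (EventuallyEq.trans ?_ (coe_ae_eq_rep g).symm)
    filter_upwards [ae_mem_ball_bergmanMeasure α] with z hz using h z hz

end Bergman

/-! ### Multiplication operators -/

theorem ae_norm_mul_rep_le {α : ℝ} {hα : -1 < α} {φ : ℂ → ℂ}
    (hb : ∀ z ∈ ball (0 : ℂ) 1, ‖φ z‖ ≤ 1) (f : Bergman α hα) :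
    ∀ᵐ z ∂(bergmanMeasure α),
      ‖φ z * Bergman.rep f z‖ ≤ ‖(f : Lp ℂ 2 (bergmanMeasure α)) z‖ := by
  filter_upwards [ae_mem_ball_bergmanMeasure α, Bergman.coe_ae_eq_rep f] with z hz h
  rw [h, norm_mul]
  exact mul_le_of_le_one_left (norm_nonneg _) (hb z hz)

theorem memLp_mul_rep {α : ℝ} {hα : -1 < α} {φ : ℂ → ℂ} (hφ : DifferentiableOn ℂ φ (ball 0 1))
    (hb : ∀ z ∈ ball (0 : ℂ) 1, ‖φ z‖ ≤ 1) (f : Bergman α hα) :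
    MemLp (fun z => φ z * Bergman.rep f z) 2 (bergmanMeasure α) :=
  (Lp.memLp (f : Lp ℂ 2 (bergmanMeasure α))).of_le
    (aestronglyMeasurable_bergmanMeasure α (hφ.mul (Bergman.differentiableOn_rep f)))
    (ae_norm_mul_rep_le hb f)

/-- The multiplication (analytic Toeplitz) operator `T_φ f = φ f` on `A²_α`, for `φ` in the closed
unit ball of `H^∞`. -/
def mulOp (α : ℝ) (hα : -1 < α) (φ : ℂ → ℂ) (hφ : DifferentiableOn ℂ φ (ball 0 1))
    (hb : ∀ z ∈ ball (0 : ℂ) 1, ‖φ z‖ ≤ 1) : Bergman α hα →L[ℂ] Bergman α hα :=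
  LinearMap.mkContinuous
    { toFun := fun f => ⟨(memLp_mul_rep hφ hb f).toLp, fun z => φ z * Bergman.rep f z,
        hφ.mul (Bergman.differentiableOn_rep f), MemLp.coeFn_toLp _⟩
      map_add' := by
        intro f g
        refine Subtype.ext ?_
        change _ = (memLp_mul_rep hφ hb f).toLp + (memLp_mul_rep hφ hb g).toLp
        rw [← MemLp.toLp_add, MemLp.toLp_eq_toLp_iff]
        filter_upwards [ae_mem_ball_bergmanMeasure α] with z hz
        have := Bergman.rep_add f g hz
        simp only [Pi.add_apply] at this ⊢
        rw [this, mul_add]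
      map_smul' := by
        intro c f
        refine Subtype.ext ?_
        change _ = c • (memLp_mul_rep hφ hb f).toLp
        rw [← MemLp.toLp_const_smul, MemLp.toLp_eq_toLp_iff]
        filter_upwards [ae_mem_ball_bergmanMeasure α] with z hz
        have := Bergman.rep_smul c f hz
        simp only [Pi.smul_apply, smul_eq_mul] at this ⊢
        rw [this]; ring }
    1
    (by
      intro f
      rw [one_mul]
      change ‖(memLp_mul_rep hφ hb f).toLp‖ ≤ ‖(f : Lp ℂ 2 (bergmanMeasure α))‖
      refine Lp.norm_le_norm_of_ae_le ?_
      filter_upwards [(memLp_mul_rep hφ hb f).coeFn_toLp, ae_norm_mul_rep_le hb f] with z h1 h2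
      rw [h1]; exact h2)

theorem mulOp_apply (α : ℝ) (hα : -1 < α) (φ : ℂ → ℂ) (hφ : DifferentiableOn ℂ φ (ball 0 1))
    (hb : ∀ z ∈ ball (0 : ℂ) 1, ‖φ z‖ ≤ 1) (f : Bergman α hα) (z : 𝔻) :
    mulOp α hα φ hφ hb f z = φ z * f z :=
  Bergman.rep_eqOn (mulOp α hα φ hφ hb f) (hφ.mul (Bergman.differentiableOn_rep f))
    (MemLp.coeFn_toLp (memLp_mul_rep hφ hb f)) (Bergman.mem_ball z)

/-! ### The range space of a defect operator -/

section DefectSpace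

variable {H : Type*} [NormedAddCommGroup H] [InnerProductSpace ℂ H] [CompleteSpace H]

/-- The defect operator `(I - T T*)^{1/2}`. -/
def defectOp (T : H →L[ℂ] H) : H →L[ℂ] H :=
  CFC.sqrt (1 - T * star T)

/-- The space `H(T)`: the range of `D = (I - T T*)^{1/2}` with the inner product
`⟪D x, D y⟫ = ⟪x, y⟫` for `x, y ⊥ ker D`. It is modelled on `(ker D)ᗮ`, on which `D` is injective
and has the same range as on the whole space: `x : DefectSpace T` stands for `D x`. -/
def DefectSpace (T : H →L[ℂ] H) : Type _ :=
  ↥((defectOp T).kerᗮ)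

variable (T : H →L[ℂ] H)

instance : NormedAddCommGroup (DefectSpace T) :=
  inferInstanceAs (NormedAddCommGroup ↥((defectOp T).kerᗮ))

instance : InnerProductSpace ℂ (DefectSpace T) :=
  inferInstanceAs (InnerProductSpace ℂ ↥((defectOp T).kerᗮ))

instance : CompleteSpace (DefectSpace T) :=
  inferInstanceAs (CompleteSpace ↥((defectOp T).kerᗮ))

/-- The inclusion of `H(T)` in `H`, sending the element represented by `x ⊥ ker D` to `D x`. -/
def DefectSpace.incl : DefectSpace T →L[ℂ] H :=
  (defectOp T) ∘L ((defectOp T).kerᗮ).subtypeL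

theorem DefectSpace.incl_injective : Function.Injective (DefectSpace.incl T) := by
  refine (injective_iff_map_eq_zero _).2 fun x hx => ?_
  have hk : (x.1 : H) ∈ (defectOp T).ker := hx
  have h0 : (x.1 : H) = 0 := by
    have := Submodule.inner_right_of_mem_orthogonal hk x.2
    exact inner_self_eq_zero.1 this
  exact Subtype.ext h0

theorem DefectSpace.range_incl :
    Set.range (DefectSpace.incl T) = Set.range (defectOp T) := by
  ext y
  constructor
  · rintro ⟨x, rfl⟩
    exact ⟨x.1, rfl⟩
  · rintro ⟨x, rfl⟩
    have hc : IsClosed ((defectOp T).ker : Set H) := (defectOp T).isClosed_ker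
    have : CompleteSpace (defectOp T).ker := hc.completeSpace_coe
    obtain ⟨u, hu, v, hv, rfl⟩ := (defectOp T).ker.exists_add_mem_mem_orthogonal x
    refine ⟨⟨v, hv⟩, ?_⟩
    have hu0 : defectOp T u = 0 := hu
    rw [map_add, hu0, zero_add]
    rfl

/-- If `H` is a Hilbert space of functions then so is `H(T)`; the function of an element of
`H(T)` is its function as an element of `H`. -/
instance DefectSpace.instRKHS {X : Type*} [RKHS ℂ H X ℂ] : RKHS ℂ (DefectSpace T) X ℂ where
  coeCLM := (RKHS.coeCLM ℂ (H := H)) ∘L DefectSpace.incl T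
  coeCLM_injective := (RKHS.coeCLM_injective (𝕜 := ℂ) (H := H)).comp (DefectSpace.incl_injective T)

end DefectSpace

/-- The sub-Bergman space `H^α(φ) = H(T_φ)`. -/
abbrev SubBergman (α : ℝ) (hα : -1 < α) (φ : ℂ → ℂ) (hφ : DifferentiableOn ℂ φ (ball 0 1))
    (hb : ∀ z ∈ ball (0 : ℂ) 1, ‖φ z‖ ≤ 1) : Type :=
  DefectSpace (mulOp α hα φ hφ hb)

/-- The scalar reproducing kernel `K(z, w) = K_w(z)` of a Hilbert space of functions on `X`:
`f(w) = ⟪f, K_w⟫`, linear in `f`. -/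
def scalarKernel (H : Type*) {X : Type*} [NormedAddCommGroup H] [InnerProductSpace ℂ H]
    [CompleteSpace H] [RKHS ℂ H X ℂ] (z w : X) : ℂ :=
  RKHS.kernel H z w 1

/-! ### Complete Nevanlinna-Pick kernels -/

/-- A kernel function on `Ω`: positive semidefinite on every finite set of points. -/
def IsKernelFunction {Ω : Type u} (K : Ω → Ω → ℂ) : Prop :=
  Matrix.PosSemidef (Matrix.of K)

/-- A kernel is irreducible if it vanishes nowhere and the kernel functions of two distinct
points are linearly independent. -/
def IsIrreducibleKernel {Ω : Type u} (K : Ω → Ω → ℂ) : Prop :=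
  (∀ z w, K z w ≠ 0) ∧
    ∀ z w, z ≠ w → LinearIndependent ℂ ![fun x => K x z, fun x => K x w]

/-- A complete Nevanlinna-Pick kernel: an irreducible kernel function of the form
`K(z, w) = δ(z) conj(δ(w)) / (1 - ⟨b(z), b(w)⟩)`, where `b` takes values in a Hilbert space and `δ`
vanishes nowhere. The pairing `⟨b(z), b(w)⟩`, linear in `b(z)`, is `⟪b w, b z⟫_ℂ`. -/
def IsCNPKernel {Ω : Type u} (K : Ω → Ω → ℂ) : Prop :=
  IsKernelFunction K ∧ IsIrreducibleKernel K ∧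
    ∃ (L : Type u) (_ : NormedAddCommGroup L) (_ : InnerProductSpace ℂ L) (_ : CompleteSpace L)
      (b : Ω → L) (δ : Ω → ℂ), (∀ z, δ z ≠ 0) ∧
        ∀ z w, 1 - ⟪b w, b z⟫_ℂ ≠ 0 ∧ K z w = δ z * conj (δ w) / (1 - ⟪b w, b z⟫_ℂ)

/-- A Möbius map of the disk: `φ(z) = ζ (a - z) / (1 - conj(a) z)` with `|ζ| = 1`, `|a| < 1`. -/
def IsMobius (φ : ℂ → ℂ) : Prop :=
  ∃ ζ a : ℂ, ‖ζ‖ = 1 ∧ ‖a‖ < 1 ∧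
    ∀ z ∈ ball (0 : ℂ) 1, φ z = ζ * ((a - z) / (1 - conj a * z))

end

/-! ### Circle averages of power series -/

/-! Write β = 2 + α, so 1 < β ≤ 2. Composition with the involution of the disk that exchanges 0 and
a turns the mean value property of dA_α at 0 into the reproducing property of (1 - z conj w)^(-β)
(`integral_mul_conj_bergmanKernelFun`). The kernel functions k_w are eigenvectors of the adjoint of
T_φ, and the kernel of H(T) at w is (I - TT*) k_w; this gives the formula for the kernel.

If φ is a Möbius map, 1 - φ(z) conj φ(w) contains the factor 1 - z conj w. A rescaling of (1 - z
conj w)^(-s) with s = 1 + α remains, and it is a complete Pick kernel because 1 - (1 - x)^s has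
nonnegative Taylor coefficients for 0 < s ≤ 1.

Conversely, normalize a complete Pick kernel at 0. On the function side this replaces φ by ψ = (φ -
a)/(1 - conj a φ) with a = φ(0). On the Hilbert space side it gives a Drury-Arveson kernel moved by
a ball automorphism, which has the form 1/(1 - t) with |t| < 1, hence real part at least 1/2
(`half_le_re_normalized_drury_arveson`). So Re ((1 - ψ(z) conj ψ(w))/(1 - z conj w)^β) ≥ 1/2, and
`exists_eq_mul_of_half_le_re` deduces that ψ is a rotation.

That rigidity has two stages. Averaging over rotations replaces ψ(z) conj ψ(w) by Σ |a_n|² x^n with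
x = z conj w. Since β > 1, x can approach 1 from a direction in which (1 - x)^(-β) has very negative
real part, which forces Σ |a_n|² ≥ 1 (`one_le_tsum_norm_coeff_sq`). Thus ψ is inner, and letting w
tend to a point where |ψ(w)| tends to 1 gives |1 - z conj v|^β ≤ 2 |1 - ψ(z) conj η| with |v| ≤ 1 =
|η|. Now the function h = (1 + u)/(1 - u), u = ψ conj η, has positive real part, and as u is inner
its boundary measure is singular and lives where u = 1; the inequality leaves only the point v
there. Quantitatively, integrating |1 - z conj v|² against Re h on circles gives 1 + |v|² ≤ 2 Re(v
conj η ψ'(0)) in the limit (`norm_deriv_bound`). Hence |ψ'(0)| ≥ 1, and the Schwarz lemma finishes.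
-/

theorem HasSum.congr_term {E : Type*} [AddCommMonoid E] [TopologicalSpace E] {f g : ℕ → E} {s : E}
    (h : HasSum f s) (e : ∀ n, f n = g n) : HasSum g s :=
  (funext e : f = g) ▸ h

theorem hasSum_circleAverage {F : ℕ → ℂ → ℂ} {f : ℂ → ℂ} {b : ℕ → ℝ} {r : ℝ} (hb : Summable b)
    (hc : ∀ n, ContinuousOn (F n) (sphere 0 |r|)) (hF : ∀ n, ∀ z ∈ sphere (0 : ℂ) |r|, ‖F n z‖ ≤ b n)
    (hf : ∀ z ∈ sphere (0 : ℂ) |r|, HasSum (fun n => F n z) (f z)) :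
    HasSum (fun n => Real.circleAverage (F n) 0 r) (Real.circleAverage f 0 r) := by
  refine HasSum.const_smul _ ?_
  refine intervalIntegral.hasSum_integral_of_dominated_convergence (fun n _ => b n) ?_ ?_ ?_ ?_ ?_
  · intro n
    refine Continuous.aestronglyMeasurable ?_
    rw [← continuousOn_univ]
    exact (hc n).comp (continuous_circleMap 0 r).continuousOn
      fun θ _ => circleMap_mem_sphere' 0 r θ
  · exact fun n => ae_of_all _ fun θ _ => hF n _ (circleMap_mem_sphere' 0 r θ)
  · exact ae_of_all _ fun θ _ => hb
  · exact intervalIntegrable_const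
  · exact ae_of_all _ fun θ _ => hf _ (circleMap_mem_sphere' 0 r θ)

theorem circleAverage_conj (f : ℂ → ℂ) (r : ℝ) (hf : CircleIntegrable f 0 r) :
    Real.circleAverage (fun z => conj (f z)) 0 r = conj (Real.circleAverage f 0 r) :=
  (conjCLE : ℂ →L[ℝ] ℂ).circleAverage_comp_comm hf

theorem circleAverage_re (f : ℂ → ℂ) (r : ℝ) (hf : CircleIntegrable f 0 r) :
    Real.circleAverage (fun z => (f z).re) 0 r = (Real.circleAverage f 0 r).re :=
  reCLM.circleAverage_comp_comm hf

theorem circleAverage_ofReal (f : ℂ → ℝ) (r : ℝ) (hf : CircleIntegrable f 0 r) :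
    Real.circleAverage (fun z => (f z : ℂ)) 0 r = (Real.circleAverage f 0 r : ℝ) :=
  ofRealCLM.circleAverage_comp_comm hf

theorem circleAverage_pow (n : ℕ) (r : ℝ) :
    Real.circleAverage (fun z : ℂ => z ^ n) 0 r = 0 ^ n :=
  DiffContOnCl.circleAverage (f := fun z : ℂ => z ^ n) (c := 0) (R := r)
    (by fun_prop : Differentiable ℂ fun z : ℂ => z ^ n).diffContOnCl

/-- On the circle z conj z = r² is constant, which reduces the product to a single power of z; `0 ^
m` keeps the case m = 0. -/
theorem circleAverage_pow_mul_conj_pow_add (j m : ℕ) (r : ℝ) :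
    Real.circleAverage (fun z : ℂ => z ^ (j + m) * conj z ^ j) 0 r =
      (r : ℂ) ^ (2 * j) * 0 ^ m := by
  have h : Set.EqOn (fun z : ℂ => z ^ (j + m) * conj z ^ j)
      (fun z => ((r : ℂ) ^ (2 * j)) • z ^ m) (sphere 0 |r|) := by
    intro z hz
    have hz' : z * conj z = (r : ℂ) ^ 2 := by
      rw [mul_conj, normSq_eq_norm_sq, mem_sphere_zero_iff_norm.1 hz, sq_abs]; push_cast; rfl
    simp only [smul_eq_mul]
    rw [pow_add, mul_right_comm, ← mul_pow, hz', ← pow_mul]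
  rw [Real.circleAverage_congr_sphere h, Real.circleAverage_fun_smul, circleAverage_pow,
    smul_eq_mul]

theorem circleAverage_pow_mul_conj_pow (j k : ℕ) (r : ℝ) :
    Real.circleAverage (fun z : ℂ => z ^ j * conj z ^ k) 0 r =
      if k = j then (r : ℂ) ^ (2 * j) else 0 := by
  rcases le_total k j with h | h
  · obtain ⟨m, rfl⟩ := Nat.exists_eq_add_of_le h
    rw [circleAverage_pow_mul_conj_pow_add]
    rcases eq_or_ne m 0 with rfl | hm
    · simp
    · rw [if_neg (by omega)]; simp [hm]
  · obtain ⟨m, rfl⟩ := Nat.exists_eq_add_of_le h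
    have : (fun z : ℂ => z ^ j * conj z ^ (j + m)) =
        fun z : ℂ => conj (z ^ (j + m) * conj z ^ j) := by
      funext z; simp [mul_comm]
    rw [this, circleAverage_conj _ _ (ContinuousOn.circleIntegrable' (by fun_prop)),
      circleAverage_pow_mul_conj_pow_add]
    rcases eq_or_ne m 0 with rfl | hm
    · simp
    · rw [if_neg (by omega)]; simp [hm]

/-- An analytic function on the unit disk is the sum of a power series. -/
theorem exists_hasSum_pow {ψ : ℂ → ℂ} (hψ : DifferentiableOn ℂ ψ (ball 0 1)) :
    ∃ a : ℕ → ℂ, a 1 = deriv ψ 0 ∧ ∀ z ∈ ball (0 : ℂ) 1, HasSum (fun n => a n * z ^ n) (ψ z) := by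
  refine ⟨fun n => (n.factorial : ℂ)⁻¹ * iteratedDeriv n ψ 0, by simp, fun z hz => ?_⟩
  refine (hasSum_taylorSeries_on_ball hψ hz).congr_term fun n => ?_
  simp only [sub_zero, smul_eq_mul]
  ring

section PowerSeries

variable {ψ : ℂ → ℂ} {a : ℕ → ℂ}

theorem summable_norm_coeff_mul_pow (ha : ∀ z ∈ ball (0 : ℂ) 1, HasSum (fun n => a n * z ^ n) (ψ z))
    {r : ℝ} (hr0 : 0 ≤ r) (hr : r < 1) : Summable fun n => ‖a n‖ * r ^ n := by
  have := (ha r (by simpa [abs_of_nonneg hr0] using hr)).summable.norm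
  simpa [abs_of_nonneg hr0] using this

theorem continuousOn_of_hasSum_pow
    (ha : ∀ z ∈ ball (0 : ℂ) 1, HasSum (fun n => a n * z ^ n) (ψ z)) {r : ℝ} (hr : r < 1) :
    ContinuousOn ψ (closedBall 0 r) := by
  rcases lt_or_ge r 0 with h0 | h0
  · simp [closedBall_eq_empty.2 h0]
  have : ContinuousOn (fun z => ∑' n, a n * z ^ n) (closedBall (0 : ℂ) r) := by
    refine continuousOn_tsum (fun n => by fun_prop) (summable_norm_coeff_mul_pow ha h0 hr) ?_
    intro n z hz
    rw [norm_mul, norm_pow]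
    have : ‖z‖ ≤ r := by simpa using hz
    gcongr
  exact this.congr fun z hz => (ha z (closedBall_subset_ball hr hz)).tsum_eq.symm

/-- Orthogonality of the powers on the circle kills every term of the conjugate series except the
one of index j. -/
theorem circleAverage_pow_mul_conj (ha : ∀ z ∈ ball (0 : ℂ) 1, HasSum (fun n => a n * z ^ n) (ψ z))
    {r : ℝ} (hr0 : 0 ≤ r) (hr : r < 1) (j : ℕ) :
    Real.circleAverage (fun z => z ^ j * conj (ψ z)) 0 r = conj (a j) * (r : ℂ) ^ (2 * j) := by
  have h := hasSum_circleAverage (F := fun n z => conj (a n) * (z ^ j * conj z ^ n))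
    (f := fun z => z ^ j * conj (ψ z)) (r := r)
    ((summable_norm_coeff_mul_pow ha hr0 hr).mul_left (r ^ j)) (fun n => by fun_prop) ?_ ?_
  · have e : ∀ n, Real.circleAverage (fun z : ℂ => conj (a n) * (z ^ j * conj z ^ n)) 0 r =
        if n = j then conj (a j) * (r : ℂ) ^ (2 * j) else 0 := by
      intro n
      have := Real.circleAverage_fun_smul (a := conj (a n)) (f := fun z : ℂ => z ^ j * conj z ^ n)
        (c := 0) (R := r)
      simp only [smul_eq_mul] at this
      rw [this, circleAverage_pow_mul_conj_pow]
      split_ifs with h <;> simp [h]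
    simp only [e] at h
    exact h.unique (hasSum_ite_eq j _)
  · intro n z hz
    have hz : ‖z‖ = r := by simpa [abs_of_nonneg hr0] using hz
    simp only [norm_mul, norm_pow, RCLike.norm_conj, hz]
    exact le_of_eq (by ring)
  · intro z hz
    have hz : ‖z‖ = r := by simpa [abs_of_nonneg hr0] using hz
    have := (hasSum_conj'.2 (ha z (by simpa [hz] using hr))).mul_left (z ^ j)
    refine this.congr_term fun n => ?_
    simp only [map_mul, map_pow]
    ring

/-- Parseval's identity, in polarized form. -/
theorem hasSum_circleAverage_mul_conj
    (ha : ∀ z ∈ ball (0 : ℂ) 1, HasSum (fun n => a n * z ^ n) (ψ z))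
    {r : ℝ} (hr0 : 0 ≤ r) (hr : r < 1) {c : ℂ} (hc : ‖c‖ ≤ 1) :
    HasSum (fun n => (‖a n‖ ^ 2 : ℂ) * ((r : ℂ) ^ 2 * c) ^ n)
      (Real.circleAverage (fun z => ψ (c * z) * conj (ψ z)) 0 r) := by
  have hcont : ContinuousOn ψ (sphere 0 |r|) :=
    (continuousOn_of_hasSum_pow ha hr).mono (by rw [abs_of_nonneg hr0]; exact sphere_subset_closedBall)
  obtain ⟨M, hM⟩ := (isCompact_sphere (0 : ℂ) |r|).exists_bound_of_continuousOn hcont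
  -- Only ψ(cz) is expanded; the factor conj ψ(z) stays whole and is paired with each power by
  -- coefficient extraction, so no double series occurs.
  have h := hasSum_circleAverage (F := fun n z => (a n * c ^ n) * (z ^ n * conj (ψ z)))
    (f := fun z => ψ (c * z) * conj (ψ z)) (r := r)
    ((summable_norm_coeff_mul_pow ha hr0 hr).mul_right M)
    (fun n => by have := continuous_conj.comp_continuousOn hcont; fun_prop) ?_ ?_
  · convert h using 2 with n
    have := Real.circleAverage_fun_smul (a := a n * c ^ n) (f := fun z : ℂ => z ^ n * conj (ψ z))
      (c := 0) (R := r)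
    simp only [smul_eq_mul] at this
    rw [this, circleAverage_pow_mul_conj ha hr0 hr, ← Complex.mul_conj']
    ring
  · intro n z hz
    have hM' := hM z hz
    have hz : ‖z‖ = r := by simpa [abs_of_nonneg hr0] using hz
    simp only [norm_mul, norm_pow, RCLike.norm_conj, hz]
    have h1 : ‖c‖ ^ n ≤ 1 := pow_le_one₀ (norm_nonneg _) hc
    calc ‖a n‖ * ‖c‖ ^ n * (r ^ n * ‖ψ z‖) ≤ ‖a n‖ * 1 * (r ^ n * M) := by gcongr
      _ = _ := by ring
  · intro z hz
    have hz : ‖z‖ = r := by simpa [abs_of_nonneg hr0] using hz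
    have hcz : ‖c * z‖ < 1 := by
      rw [norm_mul, hz]; nlinarith [norm_nonneg c]
    have := (ha (c * z) (by simpa using hcz)).mul_right (conj (ψ z))
    refine this.congr_term fun n => ?_
    simp only [mul_pow]
    ring

end PowerSeries

/-! ### Parseval's identity and square-summable coefficients -/

section Parseval

variable {ψ : ℂ → ℂ} {a : ℕ → ℂ}

theorem hasSum_circleAverage_norm_sq
    (ha : ∀ z ∈ ball (0 : ℂ) 1, HasSum (fun n => a n * z ^ n) (ψ z))
    {r : ℝ} (hr0 : 0 ≤ r) (hr : r < 1) :
    HasSum (fun n => ‖a n‖ ^ 2 * (r ^ 2) ^ n) (Real.circleAverage (fun z => ‖ψ z‖ ^ 2) 0 r) := by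
  have h := hasSum_circleAverage_mul_conj ha hr0 hr (c := 1) (by simp)
  have hcont : ContinuousOn ψ (sphere 0 |r|) :=
    (continuousOn_of_hasSum_pow ha hr).mono (by rw [abs_of_nonneg hr0]; exact sphere_subset_closedBall)
  have e : Real.circleAverage (fun z => ψ (1 * z) * conj (ψ z)) 0 r =
      (Real.circleAverage (fun z => ‖ψ z‖ ^ 2) 0 r : ℝ) := by
    rw [← circleAverage_ofReal (fun z => ‖ψ z‖ ^ 2) _ (ContinuousOn.circleIntegrable' (hcont.norm.pow 2))]
    congr 1
    funext z
    rw [one_mul, mul_conj']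
    push_cast; rfl
  rw [e] at h
  rw [← Complex.hasSum_ofReal]
  refine h.congr_term fun n => ?_
  push_cast; ring

/-- Parseval on the circle of radius r bounds each partial sum by M²; a finite sum allows r → 1. -/
theorem summable_norm_coeff_sq
    (ha : ∀ z ∈ ball (0 : ℂ) 1, HasSum (fun n => a n * z ^ n) (ψ z))
    {M : ℝ} (hM : ∀ z ∈ ball (0 : ℂ) 1, ‖ψ z‖ ≤ M) :
    Summable (fun n => ‖a n‖ ^ 2) ∧ ∑' n, ‖a n‖ ^ 2 ≤ M ^ 2 := by
  have hpart : ∀ N, ∑ n ∈ Finset.range N, ‖a n‖ ^ 2 ≤ M ^ 2 := by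
    intro N
    have hlim : Tendsto (fun r : ℝ => ∑ n ∈ Finset.range N, ‖a n‖ ^ 2 * (r ^ 2) ^ n) (𝓝[<] 1)
        (𝓝 (∑ n ∈ Finset.range N, ‖a n‖ ^ 2 * (1 ^ 2) ^ n)) :=
      (Continuous.tendsto (by fun_prop) 1).mono_left nhdsWithin_le_nhds
    simp only [one_pow, mul_one] at hlim
    refine le_of_tendsto hlim ?_
    filter_upwards [Ioo_mem_nhdsLT (show (0 : ℝ) < 1 by norm_num)] with r hr
    have hs := hasSum_circleAverage_norm_sq ha hr.1.le hr.2
    refine (hs.summable.sum_le_tsum _ fun n _ => by positivity).trans ?_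
    rw [hs.tsum_eq]
    have hcont : ContinuousOn ψ (sphere 0 |r|) := (continuousOn_of_hasSum_pow ha hr.2).mono
      (by rw [abs_of_nonneg hr.1.le]; exact sphere_subset_closedBall)
    refine Real.circleAverage_mono_on_of_le_circle
      (ContinuousOn.circleIntegrable' (hcont.norm.pow 2)) fun z hz => ?_
    have hz : ‖z‖ = r := by simpa [abs_of_nonneg hr.1.le] using hz
    have := hM z (by simpa [hz] using hr.2)
    gcongr
  exact ⟨summable_of_sum_range_le (fun n => by positivity) hpart,
    Real.tsum_le_of_sum_range_le (fun n => by positivity) hpart⟩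

theorem continuousOn_tsum_norm_coeff_sq (h : Summable fun n => ‖a n‖ ^ 2) :
    ContinuousOn (fun x : ℂ => ∑' n, (‖a n‖ ^ 2 : ℂ) * x ^ n) (closedBall 0 1) := by
  refine continuousOn_tsum (fun n => by fun_prop) h fun n x hx => ?_
  have hx : ‖x‖ ≤ 1 := by simpa using hx
  have : ‖x‖ ^ n ≤ 1 := pow_le_one₀ (norm_nonneg _) hx
  simpa using mul_le_of_le_one_right (sq_nonneg ‖a n‖) this

end Parseval

/-! ### Powers of `1 - x` on the disk and in the right half-plane -/

theorem mul_conj_mem_ball {z w : ℂ} (hz : z ∈ ball (0 : ℂ) 1) (hw : w ∈ ball (0 : ℂ) 1) :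
    z * conj w ∈ ball (0 : ℂ) 1 := by
  simp only [mem_ball_zero_iff, norm_mul, RCLike.norm_conj] at *
  nlinarith [norm_nonneg z, norm_nonneg w]

theorem one_sub_mem_slitPlane {x : ℂ} (hx : x ∈ ball (0 : ℂ) 1) : 1 - x ∈ slitPlane := by
  have : ‖-x‖ < 1 := by simpa using hx
  simpa [sub_eq_add_neg] using mem_slitPlane_of_norm_lt_one this

theorem one_sub_ne_zero_of_mem_ball {x : ℂ} (hx : x ∈ ball (0 : ℂ) 1) : 1 - x ≠ 0 :=
  slitPlane_ne_zero (one_sub_mem_slitPlane hx)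

/-- A positive factor does not change the argument, so the principal branch is multiplicative here.
-/
theorem ofReal_mul_cpow {t : ℝ} (ht : 0 < t) {c : ℂ} (hc : c ≠ 0) (β : ℝ) :
    ((t : ℂ) * c) ^ (β : ℂ) = ((t ^ β : ℝ) : ℂ) * c ^ (β : ℂ) := by
  have ht' : (t : ℂ) ≠ 0 := ofReal_ne_zero.2 ht.ne'
  rw [ofReal_cpow ht.le, cpow_def_of_ne_zero (mul_ne_zero ht' hc), cpow_def_of_ne_zero ht',
    cpow_def_of_ne_zero hc, log_ofReal_mul ht hc, ← exp_add, ← ofReal_log ht.le, add_mul]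

/-- There is a direction in the right half-plane whose `-β`-th power points to the left. -/
theorem exists_re_pos_re_inv_cpow_neg {β : ℝ} (hβ : 1 < β) (hβ2 : β ≤ 2) :
    ∃ c : ℂ, 0 < c.re ∧ c ≠ 0 ∧ ((c ^ (β : ℂ))⁻¹).re < 0 := by
  have hπ := Real.pi_pos
  have hb : 1 / β < 1 := by rw [div_lt_one (by linarith)]; exact hβ
  have hb0 : 0 < 1 / β := by positivity
  -- The midpoint of π/(2β) and π/2: the angle t stays below π/2, while βt exceeds π/2 and is at
  -- most 3π/4.
  set t : ℝ := Real.pi / 4 * (1 + 1 / β) with ht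
  have ht1 : t < Real.pi / 2 := by rw [ht]; nlinarith
  have ht0 : 0 < t := by positivity
  have htβ : t * β = Real.pi / 4 * (β + 1) := by rw [ht]; field_simp
  have harg : arg (exp (t * I)) = t := by
    rw [arg_exp_mul_I, toIocMod_eq_self]
    constructor <;> linarith
  refine ⟨exp (t * I), ?_, exp_ne_zero _, ?_⟩
  · rw [exp_ofReal_mul_I_re]
    exact Real.cos_pos_of_mem_Ioo ⟨by linarith, ht1⟩
  · rw [← cpow_neg, ← ofReal_neg, cpow_ofReal_re, norm_exp_ofReal_mul_I, harg, Real.one_rpow,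
      one_mul, mul_neg, Real.cos_neg, htβ]
    exact Real.cos_neg_of_pi_div_two_lt_of_lt (by nlinarith) (by nlinarith)

/-! ### Rigidity, first stage: the function is inner -/

section Rigidity

variable {ψ : ℂ → ℂ} {a : ℕ → ℂ} {β : ℝ}

/-- Averaging the kernel over rotations. -/
theorem half_le_re_tsum_div
    (ha : ∀ z ∈ ball (0 : ℂ) 1, HasSum (fun n => a n * z ^ n) (ψ z))
    (hK : ∀ z ∈ ball (0 : ℂ) 1, ∀ w ∈ ball (0 : ℂ) 1,
      1 / 2 ≤ ((1 - ψ z * conj (ψ w)) / (1 - z * conj w) ^ (β : ℂ)).re)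
    {x : ℂ} (hx : x ∈ ball (0 : ℂ) 1) :
    1 / 2 ≤ ((1 - ∑' n, (‖a n‖ ^ 2 : ℂ) * x ^ n) / (1 - x) ^ (β : ℂ)).re := by
  -- The pairs (cz, z) with |z| = r all satisfy cz conj z = r²c = x. Along them the denominator is
  -- constant, and averaging the numerator produces the polarized Parseval sum.
  obtain ⟨r, c, hr0, hr, hc, rfl⟩ : ∃ (r : ℝ) (c : ℂ), 0 ≤ r ∧ r < 1 ∧ ‖c‖ ≤ 1 ∧
      x = (r : ℂ) ^ 2 * c := by
    refine ⟨√‖x‖, x / ‖x‖, Real.sqrt_nonneg _, ?_, ?_, ?_⟩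
    · rw [Real.sqrt_lt' one_pos]; simpa using hx
    · simpa using div_self_le_one _
    · rw [← ofReal_pow, Real.sq_sqrt (norm_nonneg _)]
      rcases eq_or_ne x 0 with rfl | h
      · simp
      · field_simp [ofReal_ne_zero.2 (norm_ne_zero_iff.2 h)]
  have hcont := continuousOn_of_hasSum_pow ha hr
  have hmem : ∀ z ∈ sphere (0 : ℂ) |r|, ‖z‖ = r ∧ c * z ∈ closedBall (0 : ℂ) r := by
    intro z hz
    have hz : ‖z‖ = r := by simpa [abs_of_nonneg hr0] using hz
    refine ⟨hz, ?_⟩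
    rw [mem_closedBall_zero_iff, norm_mul, hz]
    exact mul_le_of_le_one_left hr0 hc
  have hcs : ContinuousOn (fun z => ψ (c * z) * conj (ψ z)) (sphere 0 |r|) := by
    refine (hcont.comp (by fun_prop) fun z hz => (hmem z hz).2).mul
      (continuous_conj.comp_continuousOn (hcont.mono ?_))
    rw [abs_of_nonneg hr0]; exact sphere_subset_closedBall
  have h1 := (hasSum_circleAverage_mul_conj ha hr0 hr hc).tsum_eq
  rw [h1]
  have hci : CircleIntegrable (fun z => ψ (c * z) * conj (ψ z)) 0 r :=
    ContinuousOn.circleIntegrable' hcs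
  set D := (1 - (r : ℂ) ^ 2 * c) ^ (β : ℂ)
  have hcs2 : ContinuousOn (fun z => D⁻¹ • (1 - ψ (c * z) * conj (ψ z))) (sphere 0 |r|) := by
    fun_prop
  have e : (1 - Real.circleAverage (fun z => ψ (c * z) * conj (ψ z)) 0 r) / D =
      Real.circleAverage (fun z => D⁻¹ • (1 - ψ (c * z) * conj (ψ z))) 0 r := by
    rw [Real.circleAverage_fun_smul, Real.circleAverage_fun_sub
      (ContinuousOn.circleIntegrable' continuousOn_const) hci, Real.circleAverage_const,
      smul_eq_mul, div_eq_inv_mul]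
  rw [e, ← circleAverage_re _ _ (ContinuousOn.circleIntegrable' hcs2),
    ← Real.circleAverage_const (1 / 2 : ℝ) 0 r]
  refine Real.circleAverage_mono (ContinuousOn.circleIntegrable' continuousOn_const)
    (ContinuousOn.circleIntegrable' (continuous_re.comp_continuousOn hcs2)) fun z hz => ?_
  obtain ⟨hz, hcz⟩ := hmem z hz
  have := hK (c * z) (closedBall_subset_ball hr hcz) z (by simpa [hz] using hr)
  have e2 : c * z * conj z = (r : ℂ) ^ 2 * c := by
    rw [mul_assoc, mul_conj', hz, mul_comm]
  rw [e2] at this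
  rwa [smul_eq_mul, ← div_eq_inv_mul]

/-- Put x = 1 - tc with c in the right half-plane and Re c^(-β) < 0. After division by t^(-β) > 0
the averaged lower bound tends, as t → 0, to (1 - Σ |a_n|²) Re c^(-β) ≥ 0. -/
theorem one_le_tsum_norm_coeff_sq (hβ : 1 < β) (hβ2 : β ≤ 2)
    (ha : ∀ z ∈ ball (0 : ℂ) 1, HasSum (fun n => a n * z ^ n) (ψ z))
    (hK : ∀ z ∈ ball (0 : ℂ) 1, ∀ w ∈ ball (0 : ℂ) 1,
      1 / 2 ≤ ((1 - ψ z * conj (ψ w)) / (1 - z * conj w) ^ (β : ℂ)).re)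
    (hs : Summable fun n => ‖a n‖ ^ 2) : 1 ≤ ∑' n, ‖a n‖ ^ 2 := by
  obtain ⟨c, hc0, hcs, hcβ⟩ := exists_re_pos_re_inv_cpow_neg hβ hβ2
  -- Since |1 - tc|² = 1 - t(2 Re c - t|c|²), it suffices that t < 2 Re c / |c|².
  have hin : ∀ᶠ t : ℝ in 𝓝[>] 0, 1 - t * c ∈ ball (0 : ℂ) 1 := by
    have hpos : 0 < 2 * c.re / normSq c := div_pos (by linarith) (normSq_pos.2 (hcs))
    filter_upwards [Ioo_mem_nhdsGT hpos] with t ht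
    have h2 : t * normSq c < 2 * c.re := (lt_div_iff₀ (normSq_pos.2 (hcs))).1 ht.2
    rw [mem_ball_zero_iff, ← sq_lt_one_iff₀ (norm_nonneg _), ← normSq_eq_norm_sq]
    have : normSq (1 - t * c) = 1 - t * (2 * c.re - t * normSq c) := by
      simp only [normSq_apply, sub_re, sub_im, one_re, one_im, re_ofReal_mul, im_ofReal_mul]
      ring
    rw [this]
    have := mul_pos ht.1 (sub_pos.2 h2)
    linarith
  set Φ : ℂ → ℂ := fun x => ∑' n, (‖a n‖ ^ 2 : ℂ) * x ^ n with hΦ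
  have hΦ1 : Φ 1 = (∑' n, ‖a n‖ ^ 2 : ℝ) := by
    simp only [hΦ, one_pow, mul_one]
    push_cast; rfl
  have hlim : Tendsto (fun t : ℝ => ((1 - Φ (1 - t * c)) * (c ^ (β : ℂ))⁻¹).re) (𝓝[>] 0)
      (𝓝 ((1 - Φ 1) * (c ^ (β : ℂ))⁻¹).re) := by
    refine (continuous_re.tendsto _).comp (Tendsto.mul_const _ (tendsto_const_nhds.sub ?_))
    have h1 := continuousOn_tsum_norm_coeff_sq hs 1 (by simp)
    refine h1.tendsto.comp (tendsto_nhdsWithin_iff.2 ⟨?_, ?_⟩)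
    · have : Tendsto (fun t : ℝ => (1 : ℂ) - t * c) (𝓝 0) (𝓝 (1 - (0 : ℝ) * c)) :=
        Continuous.tendsto (by fun_prop) 0
      simpa using this.mono_left nhdsWithin_le_nhds
    · filter_upwards [hin] with t ht using ball_subset_closedBall ht
  have hnn : 0 ≤ ((1 - Φ 1) * (c ^ (β : ℂ))⁻¹).re := by
    refine ge_of_tendsto hlim ?_
    filter_upwards [hin, self_mem_nhdsWithin] with t ht ht0
    have ht0 : 0 < t := ht0
    have h := half_le_re_tsum_div ha hK ht
    have e : (1 - (1 - t * c)) ^ (β : ℂ) = ((t ^ β : ℝ) : ℂ) * c ^ (β : ℂ) := by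
      rw [sub_sub_cancel, ofReal_mul_cpow ht0 (hcs)]
    rw [e, div_eq_mul_inv (1 - _ : ℂ), mul_inv, mul_left_comm, ← ofReal_inv, re_ofReal_mul] at h
    have hp : 0 < (t ^ β)⁻¹ := inv_pos.2 (Real.rpow_pos_of_pos ht0 _)
    -- Only the sign of the lower bound 1/2 matters from here on.
    by_contra hneg
    have := mul_neg_of_pos_of_neg hp (not_le.1 hneg)
    linarith
  rw [hΦ1, ← ofReal_one, ← ofReal_sub, re_ofReal_mul] at hnn
  by_contra hlt
  have := mul_neg_of_pos_of_neg (sub_pos.2 (not_le.1 hlt)) hcβ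
  linarith

/-- The circle averages are Σ |a_n|² r^(2n), and square-summability makes this series uniformly
convergent up to r = 1. -/
theorem tendsto_circleAverage_norm_sq
    (ha : ∀ z ∈ ball (0 : ℂ) 1, HasSum (fun n => a n * z ^ n) (ψ z))
    (hs : Summable fun n => ‖a n‖ ^ 2) :
    Tendsto (fun r : ℝ => Real.circleAverage (fun z => ‖ψ z‖ ^ 2) 0 r) (𝓝[<] 1)
      (𝓝 (∑' n, ‖a n‖ ^ 2)) := by
  have hc : ContinuousOn (fun r : ℝ => ∑' n, ‖a n‖ ^ 2 * (r ^ 2) ^ n) (Set.Icc 0 1) := by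
    refine continuousOn_tsum (fun n => by fun_prop) hs fun n r hr => ?_
    have : (r ^ 2) ^ n ≤ 1 := pow_le_one₀ (sq_nonneg r) (pow_le_one₀ hr.1 hr.2)
    rw [norm_mul, norm_pow, norm_norm, Real.norm_of_nonneg (by positivity)]
    exact mul_le_of_le_one_right (sq_nonneg ‖a n‖) this
  have h1 := (hc 1 (by simp)).tendsto
  simp only [one_pow, mul_one] at h1
  have h2 := h1.mono_left (nhdsWithin_mono 1 (Set.Ioo_subset_Icc_self (a := (0 : ℝ)) (b := 1)))
  rw [nhdsWithin_Ioo_eq_nhdsLT (show (0 : ℝ) < 1 by norm_num)] at h2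
  refine h2.congr' ?_
  filter_upwards [Ioo_mem_nhdsLT (show (0 : ℝ) < 1 by norm_num)] with r hr
  exact (hasSum_circleAverage_norm_sq ha hr.1.le hr.2).tsum_eq

/-- A function whose `H²` norm is at least `1` takes values close to the unit circle. -/
theorem exists_one_sub_lt_norm
    (ha : ∀ z ∈ ball (0 : ℂ) 1, HasSum (fun n => a n * z ^ n) (ψ z))
    (h1 : 1 ≤ ∑' n, ‖a n‖ ^ 2) {ε : ℝ} (hε : 0 < ε) : ∃ z ∈ ball (0 : ℂ) 1, 1 - ε < ‖ψ z‖ := by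
  by_contra! h
  -- This gives 1 - ε ≥ 0, without which (1 - ε)² < 1 could fail.
  have h0 := (norm_nonneg _).trans (h 0 (by simp))
  have := h1.trans (summable_norm_coeff_sq ha h).2
  nlinarith

/-- The lower bound on the kernel, pushed to a boundary point. -/
theorem exists_boundary_bound (hβ : 1 < β) (hb : ∀ z ∈ ball (0 : ℂ) 1, ‖ψ z‖ < 1)
    (ha : ∀ z ∈ ball (0 : ℂ) 1, HasSum (fun n => a n * z ^ n) (ψ z))
    (h1 : 1 ≤ ∑' n, ‖a n‖ ^ 2)
    (hK : ∀ z ∈ ball (0 : ℂ) 1, ∀ w ∈ ball (0 : ℂ) 1,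
      1 / 2 ≤ ((1 - ψ z * conj (ψ w)) / (1 - z * conj w) ^ (β : ℂ)).re) :
    ∃ v η : ℂ, ‖v‖ ≤ 1 ∧ ‖η‖ = 1 ∧ ∀ z ∈ ball (0 : ℂ) 1,
      ‖1 - z * conj v‖ ^ β ≤ 2 * ‖1 - ψ z * conj η‖ := by
  choose w hw hψw using fun n : ℕ => exists_one_sub_lt_norm ha h1 (ε := 1 / ((n : ℝ) + 1))
    (by positivity)
  -- A joint limit v of the points and η of the values. The limit v is only known to lie in the
  -- closed disk, which is all that is used later.
  obtain ⟨p, hp, k, hk, hlim⟩ := ((isCompact_closedBall (0 : ℂ) 1).prod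
    (isCompact_closedBall (0 : ℂ) 1)).tendsto_subseq (x := fun n => (w n, ψ (w n)))
    (fun n => ⟨ball_subset_closedBall (hw n), by simpa using (hb _ (hw n)).le⟩)
  have hl1 : Tendsto (fun n => w (k n)) atTop (𝓝 p.1) := (continuous_fst.tendsto p).comp hlim
  have hl2 : Tendsto (fun n => ψ (w (k n))) atTop (𝓝 p.2) := (continuous_snd.tendsto p).comp hlim
  refine ⟨p.1, p.2, by simpa using hp.1, le_antisymm (by simpa using hp.2) ?_, fun z hz => ?_⟩
  · have h2 : Tendsto (fun n : ℕ => 1 - 1 / ((n : ℝ) + 1)) atTop (𝓝 (1 - 0)) :=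
      tendsto_const_nhds.sub tendsto_one_div_add_atTop_nhds_zero_nat
    rw [sub_zero] at h2
    exact le_of_tendsto_of_tendsto' (h2.comp hk.tendsto_atTop) hl2.norm fun n => (hψw (k n)).le
  · have hf : Tendsto (fun n => ‖1 - z * conj (w (k n))‖ ^ β) atTop (𝓝 (‖1 - z * conj p.1‖ ^ β)) := by
      have h3 : Tendsto (fun n => ‖1 - z * conj (w (k n))‖) atTop (𝓝 ‖1 - z * conj p.1‖) :=
        (tendsto_const_nhds.sub (((continuous_conj.tendsto _).comp hl1).const_mul z)).norm
      exact h3.rpow_const (Or.inr (by linarith))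
    have hg : Tendsto (fun n => 2 * ‖1 - ψ z * conj (ψ (w (k n)))‖) atTop
        (𝓝 (2 * ‖1 - ψ z * conj p.2‖)) :=
      (tendsto_const_nhds.sub (((continuous_conj.tendsto _).comp hl2).const_mul (ψ z))).norm.const_mul 2
    refine le_of_tendsto_of_tendsto' hf hg fun n => ?_
    -- The modulus bound survives the limit without any choice of branch at the boundary.
    have h4 := (hK z hz _ (hw (k n))).trans (re_le_norm _)
    have hne := one_sub_ne_zero_of_mem_ball (mul_conj_mem_ball hz (hw (k n)))
    rw [norm_div, norm_cpow_real,
      le_div_iff₀ (Real.rpow_pos_of_pos (norm_pos_iff.2 hne) _)] at h4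
    linarith

end Rigidity

/-! ### Rigidity, second stage: from inner function to rotation -/

/-- The average of `Re h(z) |1 - z conj v|²` over a circle. -/
theorem circleAverage_re_mul_norm_sq {h : ℂ → ℂ} (hh : DifferentiableOn ℂ h (ball 0 1)) (v : ℂ)
    {r : ℝ} (hr0 : 0 ≤ r) (hr : r < 1) :
    Real.circleAverage (fun z => (h z).re * ‖1 - z * conj v‖ ^ 2) 0 r =
      (h 0).re * (1 + r ^ 2 * ‖v‖ ^ 2) - r ^ 2 * (v * deriv h 0).re := by
  obtain ⟨b, hb1, hb⟩ := exists_hasSum_pow hh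
  have hcl : closedBall (0 : ℂ) r ⊆ ball 0 1 := closedBall_subset_ball hr
  have hsub : sphere (0 : ℂ) |r| ⊆ ball 0 1 := by
    rw [abs_of_nonneg hr0]; exact sphere_subset_closedBall.trans hcl
  have hcs : ContinuousOn h (sphere 0 |r|) := hh.continuousOn.mono hsub
  have hdc : ∀ g : ℂ → ℂ, DifferentiableOn ℂ g (ball 0 1) → Real.circleAverage g 0 r = g 0 := by
    intro g hg
    refine DiffContOnCl.circleAverage ?_
    rw [abs_of_nonneg hr0]
    exact (hg.mono hcl).diffContOnCl_ball subset_rfl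
  have hcc : ContinuousOn (fun z => z ^ 1 * conj (h z)) (sphere 0 |r|) :=
    (continuousOn_id.pow 1).mul (continuous_conj.comp_continuousOn hcs)
  have hbar : Real.circleAverage (fun z => h z * conj z) 0 r = deriv h 0 * (r : ℂ) ^ 2 := by
    have e : (fun z => h z * conj z) = fun z => conj (z ^ 1 * conj (h z)) := by
      funext z; simp [mul_comm]
    rw [e, circleAverage_conj _ _ (ContinuousOn.circleIntegrable' hcc),
      circleAverage_pow_mul_conj hb hr0 hr, hb1]
    simp
  -- On the circle |1 - z conj v|² is a trigonometric polynomial of degree one, so only h(0) and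
  -- h'(0) contribute: the average of B vanishes, and C extracts the first Taylor coefficient.
  set A : ℂ → ℂ := fun z => ((1 + r ^ 2 * ‖v‖ ^ 2 : ℝ) : ℂ) • h z
  set B : ℂ → ℂ := fun z => conj v • (h z * z)
  set C : ℂ → ℂ := fun z => v • (h z * conj z)
  have hcz : ContinuousOn (fun z : ℂ => conj z) (sphere 0 |r|) := continuous_conj.continuousOn
  have hA : ContinuousOn A (sphere 0 |r|) := by fun_prop
  have hB : ContinuousOn B (sphere 0 |r|) := by fun_prop
  have hC : ContinuousOn C (sphere 0 |r|) := by fun_prop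
  have heq : Set.EqOn (fun z => (h z).re * ‖1 - z * conj v‖ ^ 2) (fun z => (A z - B z - C z).re)
      (sphere 0 |r|) := by
    intro z hz
    have hz : ‖z‖ = r := by simpa [abs_of_nonneg hr0] using hz
    have e1 : ((‖1 - z * conj v‖ ^ 2 : ℝ) : ℂ) =
        (1 + r ^ 2 * ‖v‖ ^ 2 : ℝ) - conj v * z - v * conj z := by
      push_cast
      rw [← mul_conj', ← hz, ← mul_conj', ← mul_conj']
      simp only [map_sub, map_mul, map_one, conj_conj]
      ring
    have e2 : A z - B z - C z = h z * ((‖1 - z * conj v‖ ^ 2 : ℝ) : ℂ) := by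
      rw [e1]; simp only [A, B, C, smul_eq_mul]; ring
    simp only [e2, re_mul_ofReal]
  rw [Real.circleAverage_congr_sphere heq,
    circleAverage_re (fun z => A z - B z - C z) _
      (ContinuousOn.circleIntegrable' ((hA.sub hB).sub hC)),
    Real.circleAverage_fun_sub (f₁ := fun z => A z - B z)
      (ContinuousOn.circleIntegrable' (hA.sub hB))
      (ContinuousOn.circleIntegrable' hC),
    Real.circleAverage_fun_sub (ContinuousOn.circleIntegrable' hA)
      (ContinuousOn.circleIntegrable' hB)]
  simp only [A, B, C]
  rw [Real.circleAverage_fun_smul, Real.circleAverage_fun_smul, Real.circleAverage_fun_smul, hbar,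
    hdc h hh, hdc (fun z => h z * z) (hh.mul differentiableOn_id)]
  simp only [smul_eq_mul, mul_zero, sub_zero, sub_re, re_ofReal_mul]
  rw [← mul_assoc, ← ofReal_pow, re_mul_ofReal]
  ring

section Rotation

variable {ψ : ℂ → ℂ} {β : ℝ}

theorem re_cayley {u : ℂ} (hu : 1 - u ≠ 0) :
    ((1 + u) / (1 - u)).re = (1 - ‖u‖ ^ 2) / ‖1 - u‖ ^ 2 := by
  have h : normSq (1 - u) ≠ 0 := by simpa using hu
  rw [div_re, ← normSq_eq_norm_sq, ← normSq_eq_norm_sq]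
  field_simp
  simp only [normSq_apply, add_re, add_im, sub_re, sub_im, one_re, one_im]
  ring

/-- The weight d² is small where the Cayley transform is large: d⁴ is controlled by |1 - u|², and |1
- u|² times the real part of the transform is 1 - |u|². The parameter ε trades this against the
total mass. -/
theorem re_cayley_mul_le (h1 : 1 < β) (h2 : β ≤ 2) {u : ℂ} (hu : ‖u‖ < 1) {d : ℝ} (hd0 : 0 < d)
    (hd2 : d ≤ 2) (hd : d ^ β ≤ 2 * ‖1 - u‖) {ε : ℝ} (hε : 0 < ε) :
    ((1 + u) / (1 - u)).re * d ^ 2 ≤ ε * ((1 + u) / (1 - u)).re + 4 / ε * (1 - ‖u‖ ^ 2) := by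
  have hne : 1 - u ≠ 0 := one_sub_ne_zero_of_mem_ball (by simpa using hu)
  have hm : 0 < ‖1 - u‖ := norm_pos_iff.2 hne
  have hu2 : 0 ≤ 1 - ‖u‖ ^ 2 := by nlinarith [norm_nonneg u]
  have hd4 : d ^ 4 ≤ 16 * ‖1 - u‖ ^ 2 := by
    -- The exponent 4 - 2β is nonnegative because β ≤ 2, so the last factor is bounded through d ≤
    -- 2.
    have e : d ^ 4 = d ^ β * d ^ β * d ^ (4 - 2 * β) := by
      rw [← Real.rpow_add hd0, ← Real.rpow_add hd0, ← Real.rpow_natCast]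
      congr 1; push_cast; ring
    have e2 : d ^ (4 - 2 * β) ≤ 4 := by
      calc d ^ (4 - 2 * β) ≤ 2 ^ (4 - 2 * β) := Real.rpow_le_rpow hd0.le hd2 (by linarith)
        _ ≤ 2 ^ (2 : ℝ) := Real.rpow_le_rpow_of_exponent_le (by norm_num) (by linarith)
        _ = 4 := by norm_num
    have hp : 0 < d ^ β := Real.rpow_pos_of_pos hd0 _
    calc d ^ 4 = d ^ β * d ^ β * d ^ (4 - 2 * β) := e
      _ ≤ (2 * ‖1 - u‖) * (2 * ‖1 - u‖) * 4 := by gcongr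
      _ = _ := by ring
  rw [re_cayley hne]
  set P := (1 - ‖u‖ ^ 2) / ‖1 - u‖ ^ 2 with hP
  have hP0 : 0 ≤ P := by positivity
  have hPe : P * ‖1 - u‖ ^ 2 = 1 - ‖u‖ ^ 2 := by rw [hP]; field_simp
  have hamgm : d ^ 2 ≤ ε + d ^ 4 / (4 * ε) := by
    rw [← sub_nonneg]
    have : ε + d ^ 4 / (4 * ε) - d ^ 2 = (2 * ε - d ^ 2) ^ 2 / (4 * ε) := by field_simp; ring
    rw [this]; positivity
  calc P * d ^ 2 ≤ P * (ε + d ^ 4 / (4 * ε)) := by gcongr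
    _ ≤ P * (ε + 16 * ‖1 - u‖ ^ 2 / (4 * ε)) := by gcongr
    _ = ε * P + 4 / ε * (P * ‖1 - u‖ ^ 2) := by field_simp; ring
    _ = _ := by rw [hPe]

/-- The inequality satisfied by the first Taylor coefficient. -/
theorem norm_deriv_bound (h1 : 1 < β) (h2 : β ≤ 2) (hψ : DifferentiableOn ℂ ψ (ball 0 1))
    (hb : ∀ z ∈ ball (0 : ℂ) 1, ‖ψ z‖ < 1) (h0 : ψ 0 = 0) {v η : ℂ} (hv : ‖v‖ ≤ 1) (hη : ‖η‖ = 1)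
    (hK : ∀ z ∈ ball (0 : ℂ) 1, ‖1 - z * conj v‖ ^ β ≤ 2 * ‖1 - ψ z * conj η‖)
    {ε : ℝ} (hε : 0 < ε) {r : ℝ} (hr0 : 0 ≤ r) (hr : r < 1) :
    1 + r ^ 2 * ‖v‖ ^ 2 - r ^ 2 * (2 * (v * (conj η * deriv ψ 0)).re) ≤
      ε + 4 / ε * (1 - Real.circleAverage (fun z => ‖ψ z‖ ^ 2) 0 r) := by
  set u : ℂ → ℂ := fun z => ψ z * conj η with hu
  have hnu : ∀ z, ‖u z‖ = ‖ψ z‖ := fun z => by simp [hu, hη]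
  have hub : ∀ z ∈ ball (0 : ℂ) 1, 1 - u z ≠ 0 := fun z hz =>
    one_sub_ne_zero_of_mem_ball (by simpa [hnu] using hb z hz)
  have hud : DifferentiableOn ℂ u (ball 0 1) := hψ.mul_const _
  -- Re h is positive harmonic with mean 1, so the term in ε contributes exactly ε; the other term
  -- averages 1 - |ψ|², which tends to 0 when ψ is inner.
  set h : ℂ → ℂ := fun z => (1 + u z) / (1 - u z) with hh
  have hhd : DifferentiableOn ℂ h (ball 0 1) := by
    refine DifferentiableOn.div (hud.const_add 1) (hud.const_sub 1) hub
  have hu0 : u 0 = 0 := by simp [hu, h0]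
  have hh0 : h 0 = 1 := by simp [hh, hu0]
  have hder : deriv h 0 = 2 * (conj η * deriv ψ 0) := by
    have d1 : HasDerivAt ψ (deriv ψ 0) 0 :=
      (hψ.differentiableAt (ball_mem_nhds _ one_pos)).hasDerivAt
    have d2 : HasDerivAt u (deriv ψ 0 * conj η) 0 := d1.mul_const _
    have d3 := (d2.const_add 1).fun_div (d2.const_sub 1) (hub 0 (by simp))
    rw [d3.deriv, hu0]
    ring
  have hcl : closedBall (0 : ℂ) r ⊆ ball 0 1 := closedBall_subset_ball hr
  have hsub : sphere (0 : ℂ) |r| ⊆ ball 0 1 := by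
    rw [abs_of_nonneg hr0]; exact sphere_subset_closedBall.trans hcl
  have hhc : ContinuousOn (fun z => (h z).re) (sphere 0 |r|) :=
    continuous_re.comp_continuousOn (hhd.continuousOn.mono hsub)
  have hψc : ContinuousOn (fun z => ‖ψ z‖ ^ 2) (sphere 0 |r|) :=
    (hψ.continuousOn.mono hsub).norm.pow 2
  have hR : Real.circleAverage (fun z => ε • (h z).re + (4 / ε) • (1 - ‖ψ z‖ ^ 2)) 0 r =
      ε + 4 / ε * (1 - Real.circleAverage (fun z => ‖ψ z‖ ^ 2) 0 r) := by
    have hmean : Real.circleAverage (fun z => (h z).re) 0 r = 1 := by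
      rw [circleAverage_re _ _ (ContinuousOn.circleIntegrable' (hhd.continuousOn.mono hsub)),
        DiffContOnCl.circleAverage, hh0, one_re]
      rw [abs_of_nonneg hr0]
      exact (hhd.mono hcl).diffContOnCl_ball subset_rfl
    rw [Real.circleAverage_fun_add (ContinuousOn.circleIntegrable' (by fun_prop))
      (ContinuousOn.circleIntegrable' (by fun_prop)), Real.circleAverage_fun_smul,
      Real.circleAverage_fun_smul, hmean,
      Real.circleAverage_fun_sub (ContinuousOn.circleIntegrable' continuousOn_const)
        (ContinuousOn.circleIntegrable' hψc), Real.circleAverage_const]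
    simp
  have hL := circleAverage_re_mul_norm_sq hhd v hr0 hr
  rw [hh0, hder, one_re, one_mul] at hL
  have e : (v * (2 * (conj η * deriv ψ 0))).re = 2 * (v * (conj η * deriv ψ 0)).re := by
    rw [mul_left_comm]; simp
  rw [← e, ← hL, ← hR]
  refine Real.circleAverage_mono (ContinuousOn.circleIntegrable' (hhc.mul (by fun_prop)))
    (ContinuousOn.circleIntegrable' (by fun_prop)) fun z hz => ?_
  have hz := hsub hz
  have hd0 : 0 < ‖1 - z * conj v‖ := by
    refine norm_pos_iff.2 (one_sub_ne_zero_of_mem_ball ?_)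
    rw [mem_ball_zero_iff, norm_mul, RCLike.norm_conj]
    have : ‖z‖ < 1 := by simpa using hz
    nlinarith [norm_nonneg z, norm_nonneg v]
  have hd2 : ‖1 - z * conj v‖ ≤ 2 := by
    refine (norm_sub_le _ _).trans ?_
    rw [norm_mul, RCLike.norm_conj, norm_one]
    have : ‖z‖ < 1 := by simpa using hz
    nlinarith [norm_nonneg z, norm_nonneg v]
  have := re_cayley_mul_le h1 h2 (u := u z) (by rw [hnu]; exact hb z hz) hd0 hd2 (hK z hz) hε
  rw [hnu] at this
  exact this

/-- If `Re ((1 - ψ(z) conj ψ(w)) / (1 - z conj w) ^ β) ≥ 1/2` on the disk, where `1 < β ≤ 2` and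
`ψ(0) = 0`, then `ψ` is a rotation. -/
theorem exists_eq_mul_of_half_le_re (h1 : 1 < β) (h2 : β ≤ 2)
    (hψ : DifferentiableOn ℂ ψ (ball 0 1)) (hb : ∀ z ∈ ball (0 : ℂ) 1, ‖ψ z‖ < 1) (h0 : ψ 0 = 0)
    (hK : ∀ z ∈ ball (0 : ℂ) 1, ∀ w ∈ ball (0 : ℂ) 1,
      1 / 2 ≤ ((1 - ψ z * conj (ψ w)) / (1 - z * conj w) ^ (β : ℂ)).re) :
    ∃ ζ : ℂ, ‖ζ‖ = 1 ∧ ∀ z ∈ ball (0 : ℂ) 1, ψ z = ζ * z := by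
  obtain ⟨a, -, ha⟩ := exists_hasSum_pow hψ
  obtain ⟨hs, hle⟩ := summable_norm_coeff_sq ha (M := 1) fun z hz => (hb z hz).le
  have hge := one_le_tsum_norm_coeff_sq h1 h2 ha hK hs
  have heq : ∑' n, ‖a n‖ ^ 2 = 1 := le_antisymm (by simpa using hle) hge
  obtain ⟨v, η, hv, hη, hvη⟩ := exists_boundary_bound h1 hb ha hge hK
  have hlim := tendsto_circleAverage_norm_sq ha hs
  rw [heq] at hlim
  set x := (v * (conj η * deriv ψ 0)).re with hx
  have hε : ∀ ε > 0, 1 + ‖v‖ ^ 2 - 2 * x ≤ 0 + ε := by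
    intro ε hε
    rw [zero_add]
    have hl1 : Tendsto (fun r : ℝ => 1 + r ^ 2 * ‖v‖ ^ 2 - r ^ 2 * (2 * x)) (𝓝[<] 1)
        (𝓝 (1 + 1 ^ 2 * ‖v‖ ^ 2 - 1 ^ 2 * (2 * x))) :=
      (Continuous.tendsto (by fun_prop) 1).mono_left nhdsWithin_le_nhds
    have hl2 : Tendsto (fun r : ℝ => ε + 4 / ε *
        (1 - Real.circleAverage (fun z => ‖ψ z‖ ^ 2) 0 r)) (𝓝[<] 1) (𝓝 (ε + 4 / ε * (1 - 1))) :=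
      tendsto_const_nhds.add ((tendsto_const_nhds.sub hlim).const_mul _)
    have := le_of_tendsto_of_tendsto hl1 hl2 (by
      filter_upwards [Ioo_mem_nhdsLT (show (0 : ℝ) < 1 by norm_num)] with r hr
      exact norm_deriv_bound h1 h2 hψ hb h0 hv hη hvη hε hr.1.le hr.2)
    simpa using this
  -- The limit r → 1 was taken first, with ε fixed; only now may ε tend to 0, since 4/ε is
  -- unbounded.
  have hx0 := le_of_forall_pos_le_add hε
  have hxle : x ≤ ‖v‖ * ‖deriv ψ 0‖ := by
    refine (re_le_norm _).trans (le_of_eq ?_)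
    rw [norm_mul, norm_mul, RCLike.norm_conj, hη, one_mul]
  have hmaps : Set.MapsTo ψ (ball 0 1) (closedBall (ψ 0) 1) := fun z hz => by
    rw [h0]; simpa using (hb z hz).le
  have hdle : ‖deriv ψ 0‖ ≤ 1 := by
    simpa using norm_dslope_le_div_of_mapsTo_ball hψ hmaps (z := 0) (by simp)
  -- If |ψ'(0)| < 1, then 1 + |v|² ≤ 2|v||ψ'(0)| would contradict (1 - |v|)² ≥ 0; the case v = 0
  -- reads 1 ≤ 0.
  have hdge : 1 ≤ ‖deriv ψ 0‖ := by
    by_contra hlt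
    rcases eq_or_lt_of_le (norm_nonneg v) with hv0 | hv0
    · rw [← hv0] at hx0 hxle
      linarith
    · nlinarith [mul_lt_mul_of_pos_left (not_le.1 hlt) hv0, sq_nonneg (1 - ‖v‖)]
  have hd1 := le_antisymm hdle hdge
  refine ⟨deriv ψ 0, hd1, fun z hz => ?_⟩
  have := affine_of_mapsTo_ball_of_norm_dslope_eq_div hψ hmaps (z₀ := 0) (by simp)
    (by simpa using hd1) hz
  simpa [h0, mul_comm] using this

end Rotation

/-! ### Complete Nevanlinna-Pick kernels and Möbius maps -/

/-! ### The Drury-Arveson kernel and ball automorphisms -/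

section Ball

variable {L : Type*} [NormedAddCommGroup L] [InnerProductSpace ℂ L]

theorem one_sub_inner_ne_zero {x y : L} (hx : ‖x‖ < 1) (hy : ‖y‖ < 1) : 1 - ⟪x, y⟫_ℂ ≠ 0 := by
  refine one_sub_ne_zero_of_mem_ball ?_
  rw [mem_ball_zero_iff]
  exact (norm_inner_le_norm x y).trans_lt (by nlinarith [norm_nonneg x, norm_nonneg y])

theorem inner_self_eq_ofReal_norm_sq (x : L) : ⟪x, x⟫_ℂ = (‖x‖ : ℂ) ^ 2 :=
  inner_self_eq_norm_sq_to_K x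

/-- The half-plane Re q ≥ 1/2 consists of the points at least as close to 1 as to 0. -/
theorem half_le_re_div {P Q : ℂ} (hQ : Q ≠ 0) (h : ‖P - Q‖ ≤ ‖P‖) : 1 / 2 ≤ (P / Q).re := by
  have h1 : ‖P / Q - 1‖ ≤ ‖P / Q‖ := by
    rw [div_sub_one hQ, norm_div, norm_div]
    gcongr
  have h2 : normSq (P / Q - 1) ≤ normSq (P / Q) := by
    rw [normSq_eq_norm_sq, normSq_eq_norm_sq]; gcongr
  simp only [normSq_apply, sub_re, sub_im, one_re, one_im] at h2
  linarith

/-- The Drury-Arveson kernel of the unit ball, normalized at a point, has real part at least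
`1 / 2`. -/
theorem half_le_re_normalized_drury_arveson {x y v : L} (hx : ‖x‖ < 1) (hy : ‖y‖ < 1)
    (hv : ‖v‖ < 1) :
    1 / 2 ≤ ((1 - ⟪v, x⟫_ℂ) * (1 - ⟪y, v⟫_ℂ) / ((1 - ⟪v, v⟫_ℂ) * (1 - ⟪y, x⟫_ℂ))).re := by
  refine half_le_re_div (mul_ne_zero (one_sub_inner_ne_zero hv hv) (one_sub_inner_ne_zero hy hx)) ?_
  have hv2 : 0 < 1 - ‖v‖ ^ 2 := by nlinarith [norm_nonneg v]
  set s := √(1 - ‖v‖ ^ 2) with hs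
  have hs0 : 0 < s := Real.sqrt_pos.2 hv2
  have hs2 : s ^ 2 = 1 - ‖v‖ ^ 2 := Real.sq_sqrt hv2.le
  have hs1 : (1 + s : ℂ) ≠ 0 := by exact_mod_cast (by positivity : (1 + s) ≠ 0)
  have hvv : ⟪v, v⟫_ℂ = 1 - (s : ℂ) ^ 2 := by
    rw [inner_self_eq_ofReal_norm_sq, ← ofReal_pow s, hs2]; simp
  -- Up to sign, U x is the numerator of the ball automorphism exchanging 0 and v, the denominator
  -- being 1 - ⟪v, x⟫. The projection onto v is written with 1/(1 + s) in place of (1 - s)/‖v‖², so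
  -- v = 0 is allowed.
  set U : L → L := fun x => (-1 + ⟪v, x⟫_ℂ / (1 + s)) • v + (s : ℂ) • x with hU
  have hUU : ∀ x y, ⟪U y, U x⟫_ℂ =
      (1 - ⟪v, x⟫_ℂ) * (1 - ⟪y, v⟫_ℂ) - (1 - ⟪v, v⟫_ℂ) * (1 - ⟪y, x⟫_ℂ) := by
    intro x y
    simp only [hU, inner_add_left, inner_add_right, inner_smul_left, inner_smul_right, map_add,
      map_neg, map_one, map_div₀, conj_ofReal, inner_conj_symm]
    rw [hvv]
    field_simp
    ring
  have hUn : ∀ x : L, ‖x‖ < 1 → ‖U x‖ ≤ ‖1 - ⟪v, x⟫_ℂ‖ := by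
    intro x hx
    have h1 : ((‖U x‖ ^ 2 : ℝ) : ℂ) = ((‖1 - ⟪v, x⟫_ℂ‖ ^ 2 - s ^ 2 * (1 - ‖x‖ ^ 2) : ℝ) : ℂ) := by
      have h2 := hUU x x
      rw [inner_self_eq_ofReal_norm_sq, hvv, inner_self_eq_ofReal_norm_sq x, ← inner_conj_symm x v] at h2
      push_cast
      rw [← mul_conj', map_sub, map_one]
      convert h2 using 1
      ring
    have h3 := ofReal_injective h1
    have h4 : 0 ≤ s ^ 2 * (1 - ‖x‖ ^ 2) := by
      have : 0 ≤ 1 - ‖x‖ ^ 2 := by nlinarith [norm_nonneg x]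
      positivity
    exact le_of_sq_le_sq (by linarith) (norm_nonneg _)
  rw [← hUU, norm_mul]
  refine (norm_inner_le_norm _ _).trans ?_
  rw [mul_comm]
  have e : ‖1 - ⟪y, v⟫_ℂ‖ = ‖1 - ⟪v, y⟫_ℂ‖ := by
    rw [← RCLike.norm_conj (1 - ⟪v, y⟫_ℂ), map_sub, map_one, inner_conj_symm]
  rw [e]
  exact mul_le_mul (hUn x hx) (hUn y hy) (norm_nonneg _) (norm_nonneg _)

end Ball

/-! ### A complete Pick kernel forces a Möbius map -/

section Pick

theorem isMobius_of_eq_mul {φ : ℂ → ℂ} {a ζ : ℂ} (ha : ‖a‖ < 1) (hζ : ‖ζ‖ = 1)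
    (hφ : ∀ z ∈ ball (0 : ℂ) 1, ‖φ z‖ < 1)
    (h : ∀ z ∈ ball (0 : ℂ) 1, (φ z - a) / (1 - conj a * φ z) = ζ * z) : IsMobius φ := by
  have hζ2 : ζ * conj ζ = 1 := by rw [mul_conj', hζ]; simp
  -- Solving for φ gives (a + ζz)/(1 + conj a ζ z), whose zero is -a conj ζ.
  refine ⟨-ζ, -(a * conj ζ), by simpa using hζ, by simpa [hζ] using ha, fun z hz => ?_⟩
  have hne : 1 - conj a * φ z ≠ 0 := by
    refine one_sub_ne_zero_of_mem_ball ?_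
    have := hφ z hz
    rw [mem_ball_zero_iff, norm_mul, RCLike.norm_conj]
    nlinarith [norm_nonneg a, norm_nonneg (φ z)]
  have hne2 : 1 + conj a * ζ * z ≠ 0 := by
    have : 1 - -(conj a * ζ * z) ≠ 0 := by
      refine one_sub_ne_zero_of_mem_ball ?_
      have : ‖z‖ < 1 := by simpa using hz
      rw [mem_ball_zero_iff, norm_neg, norm_mul, norm_mul, RCLike.norm_conj, hζ]
      nlinarith [norm_nonneg a, norm_nonneg z]
    simpa using this
  have h1 := h z hz
  rw [div_eq_iff hne] at h1
  have e1 : 1 - conj (-(a * conj ζ)) * z = 1 + conj a * ζ * z := by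
    simp only [map_neg, map_mul, conj_conj]; ring
  have e2 : -ζ * (-(a * conj ζ) - z) = a + ζ * z := by linear_combination a * hζ2
  rw [e1, ← mul_div_assoc, e2, eq_div_iff hne2]
  linear_combination h1

theorem isMobius_of_isCNPKernel {β : ℝ} (h1 : 1 < β) (h2 : β ≤ 2) {φ : ℂ → ℂ}
    (hφ : DifferentiableOn ℂ φ (ball 0 1)) (hb : ∀ z ∈ ball (0 : ℂ) 1, ‖φ z‖ ≤ 1)
    {K : 𝔻 → 𝔻 → ℂ}
    (hK : ∀ z w : 𝔻, K z w = (1 - φ z * conj (φ w)) / (1 - (z : ℂ) * conj (w : ℂ)) ^ (β : ℂ))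
    (hcnp : IsCNPKernel K) : IsMobius φ := by
  obtain ⟨-, ⟨hne, -⟩, L, _, _, _, b, δ, hδ, hbK⟩ := hcnp
  -- Nonvanishing of the kernel on the diagonal excludes unimodular values.
  have hlt : ∀ z ∈ ball (0 : ℂ) 1, ‖φ z‖ < 1 := by
    intro z hz
    refine lt_of_le_of_ne (hb z hz) fun h => hne (UnitDisc.mk z (by simpa using hz))
      (UnitDisc.mk z (by simpa using hz)) ?_
    rw [hK]
    simp only [UnitDisc.coe_mk]
    rw [mul_conj', h]; simp
  -- The kernel and |δ|² are both positive on the diagonal, so 1 - ‖b(z)‖² is positive too.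
  have hbl : ∀ z, ‖b z‖ < 1 := by
    intro z
    have hz : ‖(z : ℂ)‖ < 1 := z.norm_lt_one
    have hd : 0 < 1 - ‖(z : ℂ)‖ ^ 2 := by nlinarith [norm_nonneg (z : ℂ)]
    have hφz : 0 < 1 - ‖φ z‖ ^ 2 := by nlinarith [norm_nonneg (φ z), hlt z (Bergman.mem_ball z)]
    obtain ⟨hn, he⟩ := hbK z z
    have hkz : K z z = (((1 - ‖φ z‖ ^ 2) / (1 - ‖(z : ℂ)‖ ^ 2) ^ β : ℝ) : ℂ) := by
      rw [hK, mul_conj', mul_conj']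
      push_cast [ofReal_cpow hd.le]
      rfl
    rw [hkz, eq_div_iff hn, mul_conj', inner_self_eq_ofReal_norm_sq] at he
    have he' : (1 - ‖φ z‖ ^ 2) / (1 - ‖(z : ℂ)‖ ^ 2) ^ β * (1 - ‖b z‖ ^ 2) = ‖δ z‖ ^ 2 := by
      exact_mod_cast he
    have hpos : 0 < (1 - ‖φ z‖ ^ 2) / (1 - ‖(z : ℂ)‖ ^ 2) ^ β := by positivity
    have hδp : 0 < ‖δ z‖ ^ 2 := by have := norm_pos_iff.2 (hδ z); positivity
    rw [← he'] at hδp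
    have := (pos_iff_pos_of_mul_pos hδp).1 hpos
    nlinarith [norm_nonneg (b z)]
  set a := φ 0 with ha
  have ha1 : ‖a‖ < 1 := hlt 0 (by simp)
  have hden : ∀ z ∈ ball (0 : ℂ) 1, 1 - conj a * φ z ≠ 0 := by
    intro z hz
    refine one_sub_ne_zero_of_mem_ball ?_
    rw [mul_comm]
    exact mul_conj_mem_ball (by simpa using hlt z hz) (by simpa using ha1)
  have hden' : ∀ z ∈ ball (0 : ℂ) 1, 1 - a * conj (φ z) ≠ 0 := fun z hz =>
    one_sub_ne_zero_of_mem_ball (mul_conj_mem_ball (by simpa using ha1) (by simpa using hlt z hz))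
  set ψ : ℂ → ℂ := fun z => (φ z - a) / (1 - conj a * φ z) with hψ
  have hψψ : ∀ z ∈ ball (0 : ℂ) 1, ∀ w ∈ ball (0 : ℂ) 1, 1 - ψ z * conj (ψ w) =
      (1 - a * conj a) * (1 - φ z * conj (φ w)) / ((1 - conj a * φ z) * (1 - a * conj (φ w))) := by
    intro z hz w hw
    have h1 := hden z hz
    have h2 := hden' w hw
    simp only [hψ, map_div₀, map_sub, map_mul, map_one, conj_conj]
    rw [div_mul_div_comm, one_sub_div (mul_ne_zero h1 h2)]
    congr 1
    ring
  have hψ1 : ∀ z ∈ ball (0 : ℂ) 1, ‖ψ z‖ < 1 := by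
    intro z hz
    have h4 : 0 < 1 - ‖φ z‖ ^ 2 := by nlinarith [norm_nonneg (φ z), hlt z hz]
    have h5 : 0 < 1 - ‖a‖ ^ 2 := by nlinarith [norm_nonneg a]
    have e : ((1 - ‖ψ z‖ ^ 2 : ℝ) : ℂ) =
        (((1 - ‖a‖ ^ 2) * (1 - ‖φ z‖ ^ 2) / ‖1 - conj a * φ z‖ ^ 2 : ℝ) : ℂ) := by
      have := hψψ z hz z hz
      push_cast
      rw [← mul_conj', ← mul_conj', ← mul_conj', ← mul_conj', this]
      simp only [map_sub, map_mul, map_one, conj_conj]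
    have e' := ofReal_injective e
    have h6 := norm_pos_iff.2 (hden z hz)
    have : 0 < 1 - ‖ψ z‖ ^ 2 := by rw [e']; positivity
    nlinarith [norm_nonneg (ψ z)]
  have hψd : DifferentiableOn ℂ ψ (ball 0 1) :=
    (hφ.sub_const a).div ((hφ.const_mul _).const_sub 1) hden
  have hker : ∀ z ∈ ball (0 : ℂ) 1, ∀ w ∈ ball (0 : ℂ) 1,
      1 / 2 ≤ ((1 - ψ z * conj (ψ w)) / (1 - z * conj w) ^ (β : ℂ)).re := by
    intro z hz w hw
    set z' : 𝔻 := UnitDisc.mk z (by simpa using hz) with hz'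
    set w' : 𝔻 := UnitDisc.mk w (by simpa using hw) with hw'
    have hzz : (z' : ℂ) = z := UnitDisc.coe_mk _ _
    have hww : (w' : ℂ) = w := UnitDisc.coe_mk _ _
    -- Both sides are K(z,w) K(0,0) / (K(z,0) K(0,w)). In this quotient δ cancels, and 1 - z conj w
    -- is 1 as soon as one argument is 0.
    convert half_le_re_normalized_drury_arveson (hbl z') (hbl w') (hbl 0) using 2
    have k1 := hbK z' w'
    have k2 := hbK z' 0
    have k3 := hbK 0 w'
    have k4 := hbK 0 0
    rw [hK] at k1 k2 k3 k4
    simp only [hzz, hww, UnitDisc.coe_zero, map_zero, mul_zero, zero_mul, sub_zero, one_cpow,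
      div_one, ← ha] at k1 k2 k3 k4
    have d1 := hδ z'
    have d2 := hδ w'
    have d3 := hδ 0
    have d2' : conj (δ w') ≠ 0 := (map_ne_zero _).2 d2
    have d3' : conj (δ 0) ≠ 0 := (map_ne_zero _).2 d3
    have e2 : 1 - conj a * φ z = δ z' * conj (δ 0) / (1 - ⟪b 0, b z'⟫_ℂ) := by
      rw [← k2.2]; ring
    rw [hψψ z hz w hw, e2, k3.2, k4.2, div_right_comm, mul_div_assoc, k1.2]
    have n1 := k1.1
    have n2 := k2.1
    have n3 := k3.1
    have n4 := k4.1
    field_simp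
  obtain ⟨ζ, hζ, hrot⟩ := exists_eq_mul_of_half_le_re h1 h2 hψd hψ1 (by simp [hψ, ha]) hker
  exact isMobius_of_eq_mul ha1 hζ hlt hrot

end Pick

/-! ### Scalar kernels as Gram matrices -/

section ScalarKernel

variable {H : Type*} {X : Type u} [NormedAddCommGroup H] [InnerProductSpace ℂ H]
    [CompleteSpace H] [RKHS ℂ H X ℂ]

theorem scalarKernel_eq_of_inner_eq {w : X} {k : H} (hk : ∀ f : H, ⟪k, f⟫_ℂ = f w) (z : X) :
    scalarKernel H z w = k z := by
  have : RKHS.kerFun H w 1 = k := by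
    refine ext_inner_right ℂ fun f => ?_
    rw [RKHS.kerFun_inner, hk]; simp
  rw [scalarKernel, ← RKHS.kerFun_apply, this]

theorem scalarKernel_eq_inner (z w : X) :
    scalarKernel H z w = ⟪RKHS.kerFun H z (1 : ℂ), RKHS.kerFun H w 1⟫_ℂ := by
  rw [RKHS.kerFun_inner, RKHS.kerFun_apply]; simp [scalarKernel]

/-- The quadratic form of a Gram matrix is the squared norm of a combination of kernel functions. -/
theorem isKernelFunction_scalarKernel : IsKernelFunction (scalarKernel H : X → X → ℂ) := by
  constructor
  · ext z w
    simp only [Matrix.conjTranspose_apply, Matrix.of_apply, scalarKernel_eq_inner, RCLike.star_def,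
      inner_conj_symm]
  · intro x
    set y : H := x.sum fun i xi => xi • RKHS.kerFun H i (1 : ℂ) with hy
    have e : (x.sum fun i xi => x.sum fun j xj => star xi * Matrix.of (scalarKernel H) i j * xj) =
        ⟪y, y⟫_ℂ := by
      rw [hy, Finsupp.sum_inner]
      refine Finsupp.sum_congr fun i _ => ?_
      rw [Finsupp.inner_sum]
      refine Finsupp.sum_congr fun j _ => ?_
      rw [Matrix.of_apply, scalarKernel_eq_inner, inner_smul_right, inner_smul_left, RCLike.star_def]
      ring
    rw [e, inner_self_eq_ofReal_norm_sq, ← ofReal_pow]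
    exact_mod_cast sq_nonneg ‖y‖

end ScalarKernel

/-! ### A Möbius map gives a complete Pick kernel -/

/-- The coefficients of `1 - (1 - x) ^ s`, `0 < s ≤ 1`, are nonnegative. -/
theorem exists_nonneg_hasSum_one_sub_cpow {s : ℝ} (hs0 : 0 < s) (hs1 : s ≤ 1) :
    ∃ c : ℕ → ℝ, (∀ n, 0 ≤ c n) ∧ ∀ x ∈ ball (0 : ℂ) 1,
      HasSum (fun n => (c n : ℂ) * x ^ (n + 1)) (1 - (1 - x) ^ (s : ℂ)) := by
  set d : ℕ → ℝ := fun n => (-1) ^ n * Ring.choose s n with hd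
  have hrec : ∀ n : ℕ, (n + 1) * d (n + 1) = (n - s) * d n := by
    intro n
    have h := Ring.choose_smul_choose s (Nat.le_succ n)
    rw [Nat.succ_eq_add_one, Nat.choose_succ_self_right, Nat.add_sub_cancel_left,
      Ring.choose_one_right, nsmul_eq_mul] at h
    push_cast at h
    simp only [hd, pow_succ]
    linear_combination -(-1) ^ n * h
  have hd0 : d 0 = 1 := by simp [hd]
  have hd1 : d 1 = -s := by simp [hd]
  have hneg : ∀ n, d (n + 1) ≤ 0 := by
    intro n
    induction n with
    | zero => rw [hd1]; linarith
    | succ n ih =>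
      have h := hrec (n + 1)
      push_cast at h
      -- Here s ≤ 1 is essential: d 1 = -s is negative, and the recursion then preserves the sign
      -- because its factor is nonnegative from index 1 on.
      have h1 : 0 ≤ (n : ℝ) + 1 - s := by have := Nat.cast_nonneg (α := ℝ) n; linarith
      have h2 : ((n : ℝ) + 1 + 1) * d (n + 1 + 1) ≤ 0 := by
        rw [h]; exact mul_nonpos_of_nonneg_of_nonpos h1 ih
      by_contra hlt
      have : 0 < ((n : ℝ) + 1 + 1) * d (n + 1 + 1) := mul_pos (by positivity) (not_le.1 hlt)
      linarith
  refine ⟨fun n => -d (n + 1), fun n => neg_nonneg.2 (hneg n), fun x hx => ?_⟩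
  have hxs : (-x) ∈ eball (0 : ℂ) 1 := by
    rw [mem_eball_zero_iff]
    simpa [← ofReal_norm] using hx
  have h := one_add_cpow_hasFPowerSeriesOnBall_zero (a := (s : ℂ)) |>.hasSum hxs
  have h' : HasSum (fun n => (d n : ℂ) * x ^ n) ((1 - x) ^ (s : ℂ)) := by
    rw [zero_add, ← sub_eq_add_neg] at h
    refine h.congr_term fun n => ?_
    rw [binomialSeries_apply, ← Complex.ofReal_choose]
    simp only [List.ofFn_const, List.prod_replicate, smul_eq_mul, hd]
    rw [neg_pow]
    push_cast
    ring
  have h2 := ((hasSum_nat_add_iff' 1).2 h').neg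
  simp only [Finset.range_one, Finset.sum_singleton, pow_zero, mul_one, hd0, ofReal_one, neg_sub]
    at h2
  refine h2.congr_term fun n => ?_
  push_cast; ring

/-- The function `(1 - z conj w) ^ s` is of the form `1 - ⟨b(z), b(w)⟩`. -/
theorem exists_inner_eq_one_sub_cpow {s : ℝ} (hs0 : 0 < s) (hs1 : s ≤ 1) :
    ∃ b : 𝔻 → lp (fun _ : ℕ => ℂ) 2, ∀ z w : 𝔻,
      1 - ⟪b w, b z⟫_ℂ = (1 - (z : ℂ) * conj (w : ℂ)) ^ (s : ℂ) := by
  obtain ⟨c, hc, hsum⟩ := exists_nonneg_hasSum_one_sub_cpow hs0 hs1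
  have hmem : ∀ z : 𝔻, Memℓp (fun n : ℕ => ((√(c n) : ℝ) : ℂ) * (z : ℂ) ^ (n + 1)) 2 := by
    intro z
    refine (memℓp_gen_iff (by norm_num)).2 ?_
    have h := (hsum _ (mul_conj_mem_ball (Bergman.mem_ball z) (Bergman.mem_ball z))).summable
    rw [mul_conj', ← ofReal_pow] at h
    have h' : Summable fun n => c n * (‖(z : ℂ)‖ ^ 2) ^ (n + 1) := by exact_mod_cast h
    refine h'.congr fun n => ?_
    simp only [ENNReal.toReal_ofNat, Real.rpow_ofNat, norm_mul, norm_pow, norm_real, mul_pow,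
      Real.norm_of_nonneg (Real.sqrt_nonneg _), Real.sq_sqrt (hc n)]
    ring
  -- The feature map has coordinates √(c n) z^(n+1), so that its inner products sum the series of 1
  -- - (1 - x)^s at x = z conj w.
  refine ⟨fun z => ⟨_, hmem z⟩, fun z w => ?_⟩
  have h1 := lp.hasSum_inner (𝕜 := ℂ) (⟨_, hmem w⟩ : lp (fun _ : ℕ => ℂ) 2) ⟨_, hmem z⟩
  have h2 := hsum _ (mul_conj_mem_ball (Bergman.mem_ball z) (Bergman.mem_ball w))
  have h3 := h1.unique (h2.congr_term fun n => ?_)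
  · rw [h3, sub_sub_cancel]
  · simp only [RCLike.inner_apply, map_mul, map_pow, conj_ofReal]
    have : ((√(c n) : ℝ) : ℂ) * (√(c n) : ℝ) = c n := by
      rw [← ofReal_mul, Real.mul_self_sqrt (hc n)]
    rw [← this]
    ring

/-- A dependence, evaluated at the two points themselves, is a linear system whose determinant is
nonzero. -/
theorem linearIndependent_pair_of_mul_ne {Ω : Type*} {K : Ω → Ω → ℂ} {z w : Ω}
    (h : K z z * K w w ≠ K z w * K w z) :
    LinearIndependent ℂ ![fun x => K x z, fun x => K x w] := by
  rw [LinearIndependent.pair_iff]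
  intro s t hst
  have hz := congrFun hst z
  have hw := congrFun hst w
  simp only [Pi.add_apply, Pi.smul_apply, smul_eq_mul, Pi.zero_apply] at hz hw
  have h' := sub_ne_zero.2 h
  constructor
  · refine (mul_eq_zero.1 (?_ : s * (K z z * K w w - K z w * K w z) = 0)).resolve_right h'
    linear_combination K w w * hz - K z w * hw
  · refine (mul_eq_zero.1 (?_ : t * (K z z * K w w - K z w * K w z) = 0)).resolve_right h'
    linear_combination K z z * hw - K w z * hz

/-- The difference of the two sides is |z - w|². -/
theorem eq_of_norm_one_sub_sq_eq {z w : ℂ}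
    (h : ‖1 - z * conj w‖ ^ 2 = (1 - ‖z‖ ^ 2) * (1 - ‖w‖ ^ 2)) : z = w := by
  simp only [← normSq_eq_norm_sq, normSq_apply, sub_re, sub_im, mul_re, mul_im, conj_re, conj_im,
    one_re, one_im] at h
  have h2 : (z.re - w.re) ^ 2 + (z.im - w.im) ^ 2 = 0 := by linear_combination h
  refine Complex.ext ?_ ?_ <;> nlinarith [sq_nonneg (z.re - w.re), sq_nonneg (z.im - w.im)]

theorem isCNPKernel_of_isMobius {s : ℝ} (hs0 : 0 < s) (hs1 : s ≤ 1) {φ : ℂ → ℂ}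
    (hφ : IsMobius φ) {K : 𝔻 → 𝔻 → ℂ} (hpos : IsKernelFunction K)
    (hK : ∀ z w : 𝔻, K z w =
      (1 - φ z * conj (φ w)) / (1 - (z : ℂ) * conj (w : ℂ)) ^ ((1 + s : ℝ) : ℂ)) :
    IsCNPKernel K := by
  obtain ⟨ζ, a, hζ, ha, hφ⟩ := hφ
  obtain ⟨b, hb⟩ := exists_inner_eq_one_sub_cpow hs0 hs1
  have ha2 : 0 < 1 - ‖a‖ ^ 2 := by nlinarith [norm_nonneg a]
  have hζ2 : ζ * conj ζ = 1 := by rw [mul_conj', hζ]; simp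
  have hne : ∀ z w : 𝔻, 1 - (z : ℂ) * conj (w : ℂ) ≠ 0 := fun z w =>
    one_sub_ne_zero_of_mem_ball (mul_conj_mem_ball (Bergman.mem_ball z) (Bergman.mem_ball w))
  have hnes : ∀ z w : 𝔻, (1 - (z : ℂ) * conj (w : ℂ)) ^ (s : ℂ) ≠ 0 := fun z w =>
    (cpow_ne_zero_iff_of_exponent_ne_zero (by exact_mod_cast hs0.ne')).2 (hne z w)
  have hda : ∀ z : 𝔻, 1 - conj a * (z : ℂ) ≠ 0 := fun z => by
    rw [mul_comm]
    exact one_sub_ne_zero_of_mem_ball (mul_conj_mem_ball (Bergman.mem_ball z) (by simpa using ha))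
  -- The normalized Szegő kernel at a: δ(z) conj δ(w) is what remains of 1 - φ(z) conj φ(w) after
  -- division by 1 - z conj w.
  set δ : 𝔻 → ℂ := fun z => (√(1 - ‖a‖ ^ 2) : ℝ) / (1 - conj a * z) with hδ
  have hδ0 : ∀ z, δ z ≠ 0 := fun z =>
    div_ne_zero (ofReal_ne_zero.2 (Real.sqrt_pos.2 ha2).ne') (hda z)
  have hδc : ∀ z, conj (δ z) ≠ 0 := fun z => (map_ne_zero _).2 (hδ0 z)
  have hKδ : ∀ z w, K z w = δ z * conj (δ w) / (1 - (z : ℂ) * conj (w : ℂ)) ^ (s : ℂ) := by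
    intro z w
    have h1 := hda z
    have h2 : 1 - a * conj (w : ℂ) ≠ 0 := by
      have := (map_ne_zero (starRingEnd ℂ)).2 (hda w)
      simpa using this
    have hsq : ((√(1 - ‖a‖ ^ 2) : ℝ) : ℂ) * (√(1 - ‖a‖ ^ 2) : ℝ) = 1 - a * conj a := by
      rw [← ofReal_mul, Real.mul_self_sqrt ha2.le, mul_conj']; simp
    have e1 : δ z * conj (δ w) =
        (1 - a * conj a) / ((1 - conj a * z) * (1 - a * conj (w : ℂ))) := by
      simp only [hδ, map_div₀, map_sub, map_mul, map_one, conj_conj, conj_ofReal]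
      rw [div_mul_div_comm, hsq]
    have e2 : 1 - φ z * conj (φ w) = (1 - a * conj a) * (1 - (z : ℂ) * conj (w : ℂ)) /
        ((1 - conj a * z) * (1 - a * conj (w : ℂ))) := by
      rw [hφ z (Bergman.mem_ball z), hφ w (Bergman.mem_ball w)]
      simp only [map_div₀, map_sub, map_mul, map_one, conj_conj]
      rw [mul_mul_mul_comm, hζ2, one_mul, div_mul_div_comm, one_sub_div (mul_ne_zero h1 h2)]
      congr 1
      ring
    rw [hK, e1, e2, ofReal_add, ofReal_one, cpow_add _ _ (hne z w), cpow_one]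
    rw [mul_div_right_comm, mul_comm (1 - (z : ℂ) * conj (w : ℂ)) (_ ^ _),
      mul_div_mul_right _ _ (hne z w)]
  refine ⟨hpos, ⟨fun z w => ?_, fun z w hzw => linearIndependent_pair_of_mul_ne fun h => hzw ?_⟩,
    lp (fun _ : ℕ => ℂ) 2, inferInstance, inferInstance, inferInstance, b, δ, hδ0, fun z w => ?_⟩
  · rw [hKδ]
    exact div_ne_zero (mul_ne_zero (hδ0 z) (hδc w)) (hnes z w)
  -- The factors δ cancel from the vanishing determinant. Taking norms avoids branch questions, and
  -- s > 0 lets the power be removed.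
  · have h1 : (1 - (z : ℂ) * conj (z : ℂ)) ^ (s : ℂ) * (1 - (w : ℂ) * conj (w : ℂ)) ^ (s : ℂ) =
        (1 - (z : ℂ) * conj (w : ℂ)) ^ (s : ℂ) * (1 - (w : ℂ) * conj (z : ℂ)) ^ (s : ℂ) := by
      rw [hKδ, hKδ, hKδ, hKδ, div_mul_div_comm, div_mul_div_comm,
        div_eq_div_iff (mul_ne_zero (hnes _ _) (hnes _ _)) (mul_ne_zero (hnes _ _) (hnes _ _))] at h
      have hD : δ z * conj (δ z) * (δ w * conj (δ w)) ≠ 0 :=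
        mul_ne_zero (mul_ne_zero (hδ0 z) (hδc z)) (mul_ne_zero (hδ0 w) (hδc w))
      refine mul_left_cancel₀ hD ?_
      linear_combination -h
    have h2 := congrArg norm h1
    rw [norm_mul, norm_mul, norm_cpow_real, norm_cpow_real, norm_cpow_real, norm_cpow_real,
      ← Real.mul_rpow (norm_nonneg _) (norm_nonneg _),
      ← Real.mul_rpow (norm_nonneg _) (norm_nonneg _)] at h2
    have h3 := (Real.rpow_left_inj (by positivity) (by positivity) hs0.ne').1 h2
    have hself : ∀ z : 𝔻, ‖1 - (z : ℂ) * conj (z : ℂ)‖ = 1 - ‖(z : ℂ)‖ ^ 2 := by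
      intro z
      have : (0 : ℝ) ≤ 1 - ‖(z : ℂ)‖ ^ 2 := by nlinarith [z.norm_lt_one, norm_nonneg (z : ℂ)]
      rw [mul_conj', ← ofReal_pow, ← ofReal_one, ← ofReal_sub, norm_real, Real.norm_of_nonneg this]
    have hsymm : ‖1 - (w : ℂ) * conj (z : ℂ)‖ = ‖1 - (z : ℂ) * conj (w : ℂ)‖ := by
      rw [← RCLike.norm_conj]
      simp [mul_comm]
    rw [hself, hself, hsymm, ← sq] at h3
    exact UnitDisc.coe_injective (eq_of_norm_one_sub_sq_eq h3.symm)
  · rw [hb]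
    exact ⟨hnes z w, hKδ z w⟩

/-! ### The measure `dA_α` -/

/-- The antiderivative -(1 - r²)^(α+1) / (2(α+1)) is continuous up to r = 1 even when the weight
blows up there; a nonnegative derivative of such a function is integrable. -/
theorem integrableOn_and_integral_radial_weight {α : ℝ} (hα : -1 < α) :
    IntegrableOn (fun r : ℝ => r * (1 - r ^ 2) ^ α) (Set.Ioo 0 1) ∧
      ∫ r in Set.Ioo (0 : ℝ) 1, r * (1 - r ^ 2) ^ α = 1 / (2 * (α + 1)) := by
  have hα1 : 0 < α + 1 := by linarith
  have hc : ContinuousOn (fun r : ℝ => -(1 - r ^ 2) ^ (α + 1) / (2 * (α + 1))) (Set.Icc 0 1) :=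
    (ContinuousOn.rpow_const (by fun_prop) fun _ _ => Or.inr hα1.le).neg.div_const _
  have hd : ∀ r ∈ Set.Ioo (0 : ℝ) 1, HasDerivAt
      (fun r : ℝ => -(1 - r ^ 2) ^ (α + 1) / (2 * (α + 1))) (r * (1 - r ^ 2) ^ α) r := by
    intro r hr
    have hp : 0 < 1 - r ^ 2 := by nlinarith [hr.1, hr.2]
    have h1 : HasDerivAt (fun r : ℝ => 1 - r ^ 2) (-(2 * r)) r := by
      simpa using (hasDerivAt_pow 2 r).const_sub 1
    have h2 := (h1.rpow_const (p := α + 1) (Or.inl hp.ne')).neg.div_const (2 * (α + 1))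
    refine h2.congr_deriv ?_
    rw [add_sub_cancel_right]
    field_simp
  have hn : ∀ r ∈ Set.Ioo (0 : ℝ) 1, 0 ≤ r * (1 - r ^ 2) ^ α := fun r hr =>
    mul_nonneg hr.1.le (Real.rpow_nonneg (by nlinarith [hr.1, hr.2]) _)
  have hi := intervalIntegral.integrableOn_deriv_of_nonneg hc hd hn
  refine ⟨hi.mono_set Set.Ioo_subset_Ioc_self, ?_⟩
  rw [← integral_Ioc_eq_integral_Ioo, ← intervalIntegral.integral_of_le zero_le_one,
    intervalIntegral.integral_eq_sub_of_hasDerivAt_of_le zero_le_one hc hd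
      ((intervalIntegrable_iff_integrableOn_Ioc_of_le zero_le_one).2 hi)]
  simp only [one_pow, sub_self, Real.zero_rpow hα1.ne']
  norm_num
  field_simp

theorem bergmanWeight_lt_top (α : ℝ) (z : ℂ) : bergmanWeight α z < ∞ := ENNReal.ofReal_lt_top

theorem toReal_bergmanWeight {α : ℝ} (hα : -1 < α) {z : ℂ} (hz : z ∈ ball (0 : ℂ) 1) :
    (bergmanWeight α z).toReal = (α + 1) / Real.pi * (1 - ‖z‖ ^ 2) ^ α := by
  have h1 : ‖z‖ < 1 := by simpa using hz
  have h2 : 0 < 1 - ‖z‖ ^ 2 := by nlinarith [norm_nonneg z]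
  have h3 : 0 < α + 1 := by linarith
  exact ENNReal.toReal_ofReal (by positivity)

theorem integral_bergmanMeasure {α : ℝ} (hα : -1 < α) (g : ℂ → ℂ) :
    ∫ z, g z ∂(bergmanMeasure α) =
      ∫ z in ball (0 : ℂ) 1, ((α + 1) / Real.pi * (1 - ‖z‖ ^ 2) ^ α) • g z := by
  rw [bergmanMeasure, integral_withDensity_eq_integral_toReal_smul (measurable_bergmanWeight α)
    (ae_of_all _ (bergmanWeight_lt_top α))]
  exact setIntegral_congr_fun measurableSet_ball fun z hz => by
    simp only [toReal_bergmanWeight hα hz]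

theorem integrable_bergmanMeasure_iff {α : ℝ} (hα : -1 < α) {g : ℂ → ℂ} :
    Integrable g (bergmanMeasure α) ↔
      IntegrableOn (fun z => ((α + 1) / Real.pi * (1 - ‖z‖ ^ 2) ^ α) • g z) (ball (0 : ℂ) 1) := by
  rw [bergmanMeasure, integrable_withDensity_iff_integrable_smul' (measurable_bergmanWeight α)
    (ae_of_all _ (bergmanWeight_lt_top α))]
  exact integrableOn_congr_fun (fun z hz => by simp only [toReal_bergmanWeight hα hz])
    measurableSet_ball

theorem circle_mem_ball {r θ : ℝ} (hr : r ∈ Set.Ioo (0 : ℝ) 1) :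
    Complex.polarCoord.symm (r, θ) ∈ ball (0 : ℂ) 1 := by
  rw [mem_ball_zero_iff, norm_polarCoord_symm, abs_of_pos hr.1]
  exact hr.2

theorem polarCoord_symm_notMem_ball {r θ : ℝ} (hr : 1 ≤ r) :
    Complex.polarCoord.symm (r, θ) ∉ ball (0 : ℂ) 1 := by
  rw [mem_ball_zero_iff, norm_polarCoord_symm]
  exact not_lt.2 (hr.trans (le_abs_self r))

theorem continuous_complex_polarCoord_symm : Continuous (Complex.polarCoord.symm : ℝ × ℝ → ℂ) := by
  have : (Complex.polarCoord.symm : ℝ × ℝ → ℂ) =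
      fun p => (p.1 : ℂ) * ((Real.cos p.2 : ℂ) + (Real.sin p.2 : ℂ) * I) := by
    funext p; exact Complex.polarCoord_symm_apply p
  rw [this]
  fun_prop

/-- Integration in polar coordinates. -/
theorem integral_eq_integral_polar {F : ℂ → ℂ} (hF : Integrable F) (hm : Measurable F) :
    ∫ z, F z = ∫ r in Set.Ioi (0 : ℝ), ∫ θ in Set.Ioo (-Real.pi) Real.pi,
      r • F (Complex.polarCoord.symm (r, θ)) := by
  rw [← Complex.integral_comp_polarCoord_symm, polarCoord_target, Measure.volume_eq_prod]
  refine setIntegral_prod _ ⟨?_, ?_⟩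
  · exact (measurable_fst.smul (hm.comp continuous_complex_polarCoord_symm.measurable)).aestronglyMeasurable
  · have h := Complex.lintegral_comp_polarCoord_symm (fun z => ‖F z‖ₑ)
    rw [polarCoord_target] at h
    rw [hasFiniteIntegral_iff_enorm, ← Measure.volume_eq_prod]
    refine lt_of_le_of_lt (le_of_eq ?_) (h.trans_lt (hasFiniteIntegral_iff_enorm.1 hF.2))
    refine setLIntegral_congr_fun (measurableSet_Ioi.prod measurableSet_Ioo) fun p hp => ?_
    have hp0 : 0 < p.1 := hp.1
    simp only [smul_eq_mul, enorm_smul, Real.enorm_of_nonneg hp0.le]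

theorem measurable_indicator_of_continuousOn {F : ℂ → ℂ} {s : Set ℂ} (hs : MeasurableSet s)
    (hF : ContinuousOn F s) : Measurable (s.indicator F) := by
  classical
  have := ContinuousOn.measurable_piecewise (s := s) (f := F) (g := 0) hF continuousOn_const hs
  rwa [Set.piecewise_eq_indicator] at this

theorem integral_polar_circle {g : ℂ → ℂ} (hg : DifferentiableOn ℂ g (ball 0 1)) {r : ℝ}
    (hr : r ∈ Set.Ioo (0 : ℝ) 1) :
    ∫ θ in Set.Ioo (-Real.pi) Real.pi, g (Complex.polarCoord.symm (r, θ)) =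
      (2 * Real.pi : ℝ) * g 0 := by
  have hsub : closedBall (0 : ℂ) r ⊆ ball 0 1 := closedBall_subset_ball hr.2
  have hd : DiffContOnCl ℂ g (ball 0 |r|) := by
    rw [abs_of_pos hr.1]
    exact (hg.mono hsub).diffContOnCl_ball subset_rfl
  have havg := hd.circleAverage
  have hper : ∫ θ in (0 : ℝ)..(2 * Real.pi), g (circleMap 0 r θ) =
      ∫ θ in (-Real.pi)..Real.pi, g (circleMap 0 r θ) := by
    have := ((periodic_circleMap 0 r).comp g).intervalIntegral_add_eq 0 (-Real.pi)
    simp only [Function.comp_apply, zero_add] at this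
    rw [this]; congr 1; ring
  rw [Real.circleAverage, hper, intervalIntegral.integral_of_le (by linarith [Real.pi_pos]),
    integral_Ioc_eq_integral_Ioo] at havg
  rw [← havg, Complex.real_smul, ← mul_assoc, ← Complex.ofReal_mul,
    mul_inv_cancel₀ (by positivity), Complex.ofReal_one, one_mul]
  refine integral_congr_ae (ae_of_all _ fun θ => ?_)
  simp only [Complex.polarCoord_symm_apply, circleMap, Complex.exp_mul_I, zero_add]
  push_cast; rfl

/-- The mean value property of `dA_α`. -/
theorem integral_bergmanMeasure_eq {α : ℝ} (hα : -1 < α) {g : ℂ → ℂ}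
    (hg : DifferentiableOn ℂ g (ball 0 1)) (hi : Integrable g (bergmanMeasure α)) :
    ∫ z, g z ∂(bergmanMeasure α) = g 0 := by
  have hα1 : 0 < α + 1 := by linarith
  set W : ℂ → ℂ := fun z => ((α + 1) / Real.pi * (1 - ‖z‖ ^ 2) ^ α) • g z with hW
  have hWc : ContinuousOn W (ball 0 1) := by
    refine ContinuousOn.smul (continuousOn_const.mul (ContinuousOn.rpow_const (by fun_prop)
      fun z hz => Or.inl ?_)) hg.continuousOn
    have : ‖z‖ < 1 := by simpa using hz
    nlinarith [norm_nonneg z]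
  have hWi := (integrable_bergmanMeasure_iff hα).1 hi
  rw [integral_bergmanMeasure hα, ← integral_indicator measurableSet_ball,
    integral_eq_integral_polar ((integrable_indicator_iff measurableSet_ball).2 hWi)
      (measurable_indicator_of_continuousOn measurableSet_ball hWc)]
  -- The mean value property on each circle leaves 2(α+1) times the radial integral, which is 1.
  have hin : ∀ r ∈ Set.Ioi (0 : ℝ), (∫ θ in Set.Ioo (-Real.pi) Real.pi,
      r • (ball (0 : ℂ) 1).indicator W (Complex.polarCoord.symm (r, θ))) =
      (Set.Ioo (0 : ℝ) 1).indicator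
        (fun r => (((2 * (α + 1)) * (r * (1 - r ^ 2) ^ α) : ℝ) : ℂ) * g 0) r := by
    intro r hr
    have hr0 : 0 < r := hr
    rcases lt_or_ge r 1 with h1 | h1
    · have hrm : r ∈ Set.Ioo (0 : ℝ) 1 := ⟨hr0, h1⟩
      rw [Set.indicator_of_mem hrm]
      have e : ∀ θ, r • (ball (0 : ℂ) 1).indicator W (Complex.polarCoord.symm (r, θ)) =
          ((r * ((α + 1) / Real.pi * (1 - r ^ 2) ^ α) : ℝ) : ℂ) *
            g (Complex.polarCoord.symm (r, θ)) := by
        intro θ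
        rw [Set.indicator_of_mem (circle_mem_ball hrm), hW]
        simp only [norm_polarCoord_symm, sq_abs, real_smul]
        push_cast; ring
      simp only [e]
      rw [integral_const_mul, integral_polar_circle hg hrm, ← mul_assoc, ← ofReal_mul]
      congr 2
      have := Real.pi_pos.ne'
      field_simp
    · rw [Set.indicator_of_notMem (fun h => not_le.2 h.2 h1)]
      have e : ∀ θ, r • (ball (0 : ℂ) 1).indicator W (Complex.polarCoord.symm (r, θ)) = 0 := by
        intro θ
        rw [Set.indicator_of_notMem (polarCoord_symm_notMem_ball h1), smul_zero]
      simp only [e, integral_zero]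
  rw [setIntegral_congr_fun measurableSet_Ioi hin, setIntegral_indicator measurableSet_Ioo,
    Set.inter_eq_right.2 Set.Ioo_subset_Ioi_self, integral_mul_const, integral_complex_ofReal,
    integral_const_mul, (integrableOn_and_integral_radial_weight hα).2]
  rw [mul_one_div_cancel (by positivity)]
  simp

/-- Needed to place the kernel functions, which are bounded on the disk, in L². -/
theorem isFiniteMeasure_bergmanMeasure {α : ℝ} (hα : -1 < α) :
    IsFiniteMeasure (bergmanMeasure α) := by
  have hα1 : 0 < α + 1 := by linarith
  have hrad := (integrableOn_and_integral_radial_weight hα).1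
  refine isFiniteMeasure_withDensity (ne_of_lt ?_)
  rw [← lintegral_indicator measurableSet_ball, ← Complex.lintegral_comp_polarCoord_symm,
    polarCoord_target, Measure.volume_eq_prod]
  have hm : Measurable fun p : ℝ × ℝ => ENNReal.ofReal p.1 •
      (ball (0 : ℂ) 1).indicator (bergmanWeight α) (Complex.polarCoord.symm p) :=
    (by fun_prop : Measurable fun p : ℝ × ℝ => ENNReal.ofReal p.1).mul
      (((measurable_bergmanWeight α).indicator measurableSet_ball).comp
        continuous_complex_polarCoord_symm.measurable)
  rw [← Measure.prod_restrict, lintegral_prod _ hm.aemeasurable]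
  have hin : ∀ r ∈ Set.Ioi (0 : ℝ), (∫⁻ θ in Set.Ioo (-Real.pi) Real.pi, ENNReal.ofReal r •
      (ball (0 : ℂ) 1).indicator (bergmanWeight α) (Complex.polarCoord.symm (r, θ))) =
      (Set.Ioo (0 : ℝ) 1).indicator
        (fun r => ENNReal.ofReal ((α + 1) / Real.pi * (r * (1 - r ^ 2) ^ α)) *
          ENNReal.ofReal (2 * Real.pi)) r := by
    intro r hr
    have hr0 : 0 < r := hr
    rcases lt_or_ge r 1 with h1 | h1
    · have hrm : r ∈ Set.Ioo (0 : ℝ) 1 := ⟨hr0, h1⟩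
      rw [Set.indicator_of_mem hrm]
      have e : ∀ θ, ENNReal.ofReal r • (ball (0 : ℂ) 1).indicator (bergmanWeight α)
          (Complex.polarCoord.symm (r, θ)) =
          ENNReal.ofReal ((α + 1) / Real.pi * (r * (1 - r ^ 2) ^ α)) := by
        intro θ
        rw [Set.indicator_of_mem (circle_mem_ball hrm), bergmanWeight, norm_polarCoord_symm, sq_abs,
          smul_eq_mul, ← ENNReal.ofReal_mul hr0.le]
        congr 1
        ring
      simp only [e]
      rw [setLIntegral_const, Real.volume_Ioo]
      congr 2
      ring
    · rw [Set.indicator_of_notMem (fun h => not_le.2 h.2 h1)]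
      have e : ∀ θ, ENNReal.ofReal r • (ball (0 : ℂ) 1).indicator (bergmanWeight α)
          (Complex.polarCoord.symm (r, θ)) = 0 := by
        intro θ
        rw [Set.indicator_of_notMem (polarCoord_symm_notMem_ball h1), smul_zero]
      simp only [e, lintegral_zero]
  rw [setLIntegral_congr_fun measurableSet_Ioi hin, setLIntegral_indicator measurableSet_Ioo,
    lintegral_mul_const' _ _ ENNReal.ofReal_ne_top]
  refine ENNReal.mul_lt_top (lt_of_le_of_lt (lintegral_mono_set Set.inter_subset_left) ?_)
    ENNReal.ofReal_lt_top
  exact (hrad.const_mul ((α + 1) / Real.pi)).lintegral_lt_top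

/-! ### The reproducing kernel of the Bergman space -/

noncomputable section

/-! ### The disk involution and its Jacobian -/

/-- The involutive automorphism of the disk interchanging `0` and `a`. -/
def diskInvolution (a z : ℂ) : ℂ := (a - z) / (1 - conj a * z)

section DiskInvolution

variable {a : ℂ}

theorem one_sub_conj_mul_ne_zero (ha : a ∈ ball (0 : ℂ) 1) {z : ℂ} (hz : z ∈ ball (0 : ℂ) 1) :
    1 - conj a * z ≠ 0 := by
  rw [mul_comm]
  exact one_sub_ne_zero_of_mem_ball (mul_conj_mem_ball hz ha)

theorem one_sub_norm_sq_pos (ha : a ∈ ball (0 : ℂ) 1) : 0 < 1 - ‖a‖ ^ 2 := by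
  have : ‖a‖ < 1 := by simpa using ha
  nlinarith [norm_nonneg a]

theorem one_sub_norm_sq_diskInvolution (ha : a ∈ ball (0 : ℂ) 1) {z : ℂ}
    (hz : z ∈ ball (0 : ℂ) 1) : 1 - ‖diskInvolution a z‖ ^ 2 =
      (1 - ‖a‖ ^ 2) * (1 - ‖z‖ ^ 2) / ‖1 - conj a * z‖ ^ 2 := by
  have hne := one_sub_conj_mul_ne_zero ha hz
  have hne' : ‖1 - conj a * z‖ ^ 2 ≠ 0 := by simpa using hne
  rw [diskInvolution, norm_div, div_pow, one_sub_div hne']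
  congr 1
  apply ofReal_injective
  push_cast
  simp only [← mul_conj', map_sub, map_mul, map_one, conj_conj]
  ring

theorem diskInvolution_mem_ball (ha : a ∈ ball (0 : ℂ) 1) {z : ℂ} (hz : z ∈ ball (0 : ℂ) 1) :
    diskInvolution a z ∈ ball (0 : ℂ) 1 := by
  have h := one_sub_norm_sq_diskInvolution ha hz
  have h1 := norm_pos_iff.2 (one_sub_conj_mul_ne_zero ha hz)
  have h2 : 0 < 1 - ‖diskInvolution a z‖ ^ 2 := by
    rw [h]
    have := one_sub_norm_sq_pos ha
    have := one_sub_norm_sq_pos hz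
    positivity
  rw [mem_ball_zero_iff]
  nlinarith [norm_nonneg (diskInvolution a z)]

theorem one_sub_conj_mul_diskInvolution (ha : a ∈ ball (0 : ℂ) 1) {z : ℂ}
    (hz : z ∈ ball (0 : ℂ) 1) :
    1 - conj a * diskInvolution a z = ((1 - ‖a‖ ^ 2 : ℝ) : ℂ) * (1 - conj a * z)⁻¹ := by
  have hne := one_sub_conj_mul_ne_zero ha hz
  rw [diskInvolution, ← mul_div_assoc, one_sub_div hne, div_eq_mul_inv]
  congr 1
  push_cast
  rw [← mul_conj']
  ring

theorem diskInvolution_diskInvolution (ha : a ∈ ball (0 : ℂ) 1) {z : ℂ}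
    (hz : z ∈ ball (0 : ℂ) 1) : diskInvolution a (diskInvolution a z) = z := by
  have hne := one_sub_conj_mul_ne_zero ha hz
  have hp : ((1 - ‖a‖ ^ 2 : ℝ) : ℂ) ≠ 0 := ofReal_ne_zero.2 (one_sub_norm_sq_pos ha).ne'
  rw [diskInvolution, one_sub_conj_mul_diskInvolution ha hz, div_eq_iff
    (mul_ne_zero hp (inv_ne_zero hne)), diskInvolution, sub_div' hne, ← mul_assoc, ← div_eq_mul_inv]
  congr 1
  push_cast
  rw [← mul_conj']
  ring

theorem diskInvolution_image_ball (ha : a ∈ ball (0 : ℂ) 1) :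
    diskInvolution a '' ball 0 1 = ball 0 1 := by
  refine Set.Subset.antisymm ?_ fun z hz => ?_
  · rintro _ ⟨z, hz, rfl⟩
    exact diskInvolution_mem_ball ha hz
  · exact ⟨_, diskInvolution_mem_ball ha hz, diskInvolution_diskInvolution ha hz⟩

theorem injOn_diskInvolution (ha : a ∈ ball (0 : ℂ) 1) :
    Set.InjOn (diskInvolution a) (ball 0 1) := by
  intro z hz w hw h
  rw [← diskInvolution_diskInvolution ha hz, h, diskInvolution_diskInvolution ha hw]

theorem hasDerivAt_diskInvolution (ha : a ∈ ball (0 : ℂ) 1) {z : ℂ} (hz : z ∈ ball (0 : ℂ) 1) :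
    HasDerivAt (diskInvolution a) (-((1 - ‖a‖ ^ 2 : ℝ) : ℂ) / (1 - conj a * z) ^ 2) z := by
  have h1 : HasDerivAt (fun z => a - z) (-1) z := (hasDerivAt_id z).const_sub a
  have h2 : HasDerivAt (fun z => 1 - conj a * z) (-conj a) z := by
    simpa using ((hasDerivAt_id z).const_mul (conj a)).const_sub 1
  refine (h1.fun_div h2 (one_sub_conj_mul_ne_zero ha hz)).congr_deriv ?_
  congr 1
  push_cast
  rw [← mul_conj']
  ring

end DiskInvolution

theorem det_restrictScalars_toSpanSingleton (c : ℂ) :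
    ((ContinuousLinearMap.toSpanSingleton ℂ c).restrictScalars ℝ).det = ‖c‖ ^ 2 := by
  simp [ContinuousLinearMap.det, LinearMap.det_restrictScalars, Algebra.norm_complex_eq,
    Complex.normSq_eq_norm_sq]

/-- Change of variables under the involution `u = (a - z) / (1 - conj a z)`. -/
theorem integral_ball_comp_diskInvolution {a : ℂ} (ha : a ∈ ball (0 : ℂ) 1) (G : ℂ → ℂ) :
    (IntegrableOn G (ball 0 1) ↔ IntegrableOn (fun z =>
      ((1 - ‖a‖ ^ 2) ^ 2 / ‖1 - conj a * z‖ ^ 4) • G (diskInvolution a z)) (ball 0 1)) ∧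
    ∫ u in ball (0 : ℂ) 1, G u = ∫ z in ball (0 : ℂ) 1,
      ((1 - ‖a‖ ^ 2) ^ 2 / ‖1 - conj a * z‖ ^ 4) • G (diskInvolution a z) := by
  set f' : ℂ → ℂ →L[ℝ] ℂ := fun z => (ContinuousLinearMap.toSpanSingleton ℂ
    (-((1 - ‖a‖ ^ 2 : ℝ) : ℂ) / (1 - conj a * z) ^ 2)).restrictScalars ℝ with hf'
  have hd : ∀ z ∈ ball (0 : ℂ) 1, HasFDerivWithinAt (diskInvolution a) (f' z) (ball 0 1) z :=
    fun z hz => ((hasDerivAt_diskInvolution ha hz).hasFDerivAt.restrictScalars ℝ).hasFDerivWithinAt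
  have hdet : ∀ z, |(f' z).det| = (1 - ‖a‖ ^ 2) ^ 2 / ‖1 - conj a * z‖ ^ 4 := by
    intro z
    rw [hf', det_restrictScalars_toSpanSingleton, abs_of_nonneg (by positivity), norm_div, norm_neg,
      norm_real, norm_pow, div_pow, Real.norm_eq_abs, sq_abs, ← pow_mul]
  have h1 := integrableOn_image_iff_integrableOn_abs_det_fderiv_smul volume measurableSet_ball hd
    (injOn_diskInvolution ha) G
  have h2 := integral_image_eq_integral_abs_det_fderiv_smul volume measurableSet_ball hd
    (injOn_diskInvolution ha) G
  simp only [hdet, diskInvolution_image_ball ha] at h1 h2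
  exact ⟨h1, h2⟩

/-! ### The kernel functions and their reproducing property -/

/-- The function `z ↦ 1 / (1 - z conj w) ^ β`. -/
def bergmanKernelFun (β : ℝ) (w z : ℂ) : ℂ := 1 / (1 - z * conj w) ^ (β : ℂ)

section BergmanKernelFun

variable {β : ℝ} {w z : ℂ}

theorem one_sub_cpow_ne_zero (hz : z ∈ ball (0 : ℂ) 1) (β : ℝ) : (1 - z) ^ (β : ℂ) ≠ 0 := by
  rw [cpow_def_of_ne_zero (one_sub_ne_zero_of_mem_ball hz)]
  exact exp_ne_zero _

theorem differentiableOn_bergmanKernelFun (β : ℝ) (hw : w ∈ ball (0 : ℂ) 1) :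
    DifferentiableOn ℂ (bergmanKernelFun β w) (ball 0 1) := by
  refine (differentiableOn_const 1).div (DifferentiableOn.cpow_const (by fun_prop) ?_) ?_
  · exact fun z hz => one_sub_mem_slitPlane (mul_conj_mem_ball hz hw)
  · exact fun z hz => one_sub_cpow_ne_zero (mul_conj_mem_ball hz hw) β

theorem norm_bergmanKernelFun_le (hβ : 0 ≤ β) (hw : w ∈ ball (0 : ℂ) 1)
    (hz : z ∈ ball (0 : ℂ) 1) : ‖bergmanKernelFun β w z‖ ≤ ((1 - ‖w‖) ^ β)⁻¹ := by
  have hw1 : ‖w‖ < 1 := by simpa using hw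
  have hz1 : ‖z‖ < 1 := by simpa using hz
  rw [bergmanKernelFun, norm_div, norm_one, one_div, norm_cpow_real]
  have h1 : 1 - ‖w‖ ≤ ‖1 - z * conj w‖ := by
    have := norm_sub_norm_le (1 : ℂ) (z * conj w)
    rw [norm_one, norm_mul, RCLike.norm_conj] at this
    nlinarith [norm_nonneg w, norm_nonneg z]
  have h2 : 0 < 1 - ‖w‖ := by linarith
  gcongr

/-- The transformation rule of the weight and the kernel under the involution. -/
theorem weight_mul_conj_bergmanKernelFun_diskInvolution {a : ℂ} (ha : a ∈ ball (0 : ℂ) 1)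
    (hz : z ∈ ball (0 : ℂ) 1) (α : ℝ) :
    (((1 - ‖a‖ ^ 2) ^ 2 / ‖1 - conj a * z‖ ^ 4 * (1 - ‖diskInvolution a z‖ ^ 2) ^ α : ℝ) : ℂ) *
      conj (bergmanKernelFun (2 + α) a (diskInvolution a z)) =
      (((1 - ‖z‖ ^ 2) ^ α : ℝ) : ℂ) * bergmanKernelFun (2 + α) a z := by
  have hne := one_sub_conj_mul_ne_zero ha hz
  have hsl : 1 - conj a * z ∈ slitPlane := by
    rw [mul_comm]; exact one_sub_mem_slitPlane (mul_conj_mem_ball hz ha)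
  set p : ℝ := 1 - ‖a‖ ^ 2
  set q : ℝ := 1 - ‖z‖ ^ 2
  set m : ℝ := ‖1 - conj a * z‖
  set E : ℂ := (1 - conj a * z) ^ ((2 + α : ℝ) : ℂ) with hE
  have hp : 0 < p := one_sub_norm_sq_pos ha
  have hq : 0 < q := one_sub_norm_sq_pos hz
  have hm : 0 < m := norm_pos_iff.2 hne
  have hE0 : E ≠ 0 := by
    rw [hE, mul_comm (conj a)]; exact one_sub_cpow_ne_zero (mul_conj_mem_ball hz ha) _
  -- Up to powers of 1 - |a|², the kernel at the image point is E, and at z it is 1/E. The Jacobian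
  -- and the weight supply the factor 1/|E|² that turns conj E into 1/E.
  have hEE : E * conj E = ((m ^ 4 * (m ^ 2) ^ α : ℝ) : ℂ) := by
    rw [mul_conj', hE, norm_cpow_real, ← ofReal_pow]
    congr 1
    rw [Real.rpow_add hm, mul_pow, ← Real.rpow_natCast (m ^ α), ← Real.rpow_mul hm.le, mul_comm α,
      Real.rpow_mul hm.le, Real.rpow_natCast, Real.rpow_ofNat]
    ring
  have hk : bergmanKernelFun (2 + α) a (diskInvolution a z) = E / ((p ^ 2 * p ^ α : ℝ) : ℂ) := by
    rw [bergmanKernelFun, mul_comm _ (conj a), one_sub_conj_mul_diskInvolution ha hz,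
      ofReal_mul_cpow hp (inv_ne_zero hne), inv_cpow _ _ (slitPlane_arg_ne_pi hsl), one_div,
      mul_inv, inv_inv, Real.rpow_add hp, Real.rpow_ofNat, mul_comm, div_eq_mul_inv]
  have hk2 : bergmanKernelFun (2 + α) a z = conj E / ((m ^ 4 * (m ^ 2) ^ α : ℝ) : ℂ) := by
    have hEc : conj E ≠ 0 := (map_ne_zero _).2 hE0
    rw [bergmanKernelFun, mul_comm z, ← hE, ← hEE]
    field_simp
  have hr : p ^ 2 / m ^ 4 * (1 - ‖diskInvolution a z‖ ^ 2) ^ α =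
      q ^ α * (p ^ 2 * p ^ α) / (m ^ 4 * (m ^ 2) ^ α) := by
    rw [one_sub_norm_sq_diskInvolution ha hz, Real.div_rpow (by positivity) (by positivity),
      Real.mul_rpow hp.le hq.le, div_mul_div_comm]
    congr 1
    ring
  have hpp : ((p ^ 2 * p ^ α : ℝ) : ℂ) ≠ 0 := ofReal_ne_zero.2 (by positivity)
  rw [hk, hk2, hr, map_div₀, conj_ofReal, ofReal_div, ofReal_mul]
  field_simp

end BergmanKernelFun

/-- The reproducing property of the Bergman kernel. -/
theorem integral_mul_conj_bergmanKernelFun {α : ℝ} (hα : -1 < α) {a : ℂ} (ha : a ∈ ball (0 : ℂ) 1)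
    {g : ℂ → ℂ} (hg : DifferentiableOn ℂ g (ball 0 1))
    (hi : Integrable (fun z => g z * conj (bergmanKernelFun (2 + α) a z)) (bergmanMeasure α)) :
    ∫ z, g z * conj (bergmanKernelFun (2 + α) a z) ∂(bergmanMeasure α) = g a := by
  set c : ℝ := (α + 1) / Real.pi
  set G : ℂ → ℂ := fun z =>
    (c * (1 - ‖z‖ ^ 2) ^ α) • (g z * conj (bergmanKernelFun (2 + α) a z)) with hG
  -- After the substitution the integrand is this analytic function against dA_α, so the integral is
  -- h(0) = g(a).
  set h : ℂ → ℂ := fun z => g (diskInvolution a z) * bergmanKernelFun (2 + α) a z with hh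
  obtain ⟨h1, h2⟩ := integral_ball_comp_diskInvolution ha G
  have heq : Set.EqOn (fun z => ((1 - ‖a‖ ^ 2) ^ 2 / ‖1 - conj a * z‖ ^ 4) • G (diskInvolution a z))
      (fun z => (c * (1 - ‖z‖ ^ 2) ^ α) • h z) (ball 0 1) := by
    intro z hz
    have := weight_mul_conj_bergmanKernelFun_diskInvolution ha hz α
    simp only [hG, hh, real_smul]
    push_cast at this ⊢
    linear_combination (c : ℂ) * g (diskInvolution a z) * this
  have hhi : Integrable h (bergmanMeasure α) := by
    rw [integrable_bergmanMeasure_iff hα, ← integrableOn_congr_fun heq measurableSet_ball, ← h1]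
    exact (integrable_bergmanMeasure_iff hα).1 hi
  have hhd : DifferentiableOn ℂ h (ball 0 1) :=
    (hg.comp (fun z hz => (hasDerivAt_diskInvolution ha hz).differentiableAt.differentiableWithinAt)
      fun z hz => diskInvolution_mem_ball ha hz).mul (differentiableOn_bergmanKernelFun _ ha)
  rw [integral_bergmanMeasure hα, h2, setIntegral_congr_fun measurableSet_ball heq,
    ← integral_bergmanMeasure hα, integral_bergmanMeasure_eq hα hhd hhi]
  simp [hh, diskInvolution, bergmanKernelFun]

theorem memLp_bergmanKernelFun {α : ℝ} (hα : -1 < α) {a : ℂ} (ha : a ∈ ball (0 : ℂ) 1) :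
    MemLp (bergmanKernelFun (2 + α) a) 2 (bergmanMeasure α) := by
  have := isFiniteMeasure_bergmanMeasure hα
  refine MemLp.of_bound (aestronglyMeasurable_bergmanMeasure α
    (differentiableOn_bergmanKernelFun _ ha)) ((1 - ‖a‖) ^ (2 + α))⁻¹ ?_
  filter_upwards [ae_mem_ball_bergmanMeasure α] with z hz
  exact norm_bergmanKernelFun_le (by linarith) ha hz

/-- The kernel function of the Bergman space at a point of the disk. -/
def bergmanKernelVec (α : ℝ) (hα : -1 < α) (w : 𝔻) : Bergman α hα :=
  ⟨(memLp_bergmanKernelFun hα (Bergman.mem_ball w)).toLp, bergmanKernelFun (2 + α) w,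
    differentiableOn_bergmanKernelFun _ (Bergman.mem_ball w), MemLp.coeFn_toLp _⟩

theorem bergmanKernelVec_apply {α : ℝ} (hα : -1 < α) (w z : 𝔻) :
    bergmanKernelVec α hα w z = bergmanKernelFun (2 + α) w z :=
  Bergman.rep_eqOn (bergmanKernelVec α hα w)
    (differentiableOn_bergmanKernelFun _ (Bergman.mem_ball w))
    (MemLp.coeFn_toLp (memLp_bergmanKernelFun hα (Bergman.mem_ball w))) (Bergman.mem_ball z)

theorem inner_bergmanKernelVec {α : ℝ} (hα : -1 < α) (w : 𝔻) (f : Bergman α hα) :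
    ⟪bergmanKernelVec α hα w, f⟫_ℂ = f w := by
  have hae : (fun z => ⟪(bergmanKernelVec α hα w : Lp ℂ 2 (bergmanMeasure α)) z,
      (f : Lp ℂ 2 (bergmanMeasure α)) z⟫_ℂ) =ᵐ[bergmanMeasure α]
      fun z => Bergman.rep f z * conj (bergmanKernelFun (2 + α) w z) := by
    filter_upwards [Bergman.coe_ae_eq_rep f,
      MemLp.coeFn_toLp (memLp_bergmanKernelFun hα (Bergman.mem_ball w))] with z h1 h2
    rw [h1, RCLike.inner_apply]
    congr 2
  have hi := (L2.integrable_inner (𝕜 := ℂ) (bergmanKernelVec α hα w : Lp ℂ 2 (bergmanMeasure α))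
    (f : Lp ℂ 2 (bergmanMeasure α))).congr hae
  rw [Submodule.coe_inner, L2.inner_def, integral_congr_ae hae,
    integral_mul_conj_bergmanKernelFun hα (Bergman.mem_ball w) (Bergman.differentiableOn_rep f) hi]
  rfl

/-! ### The reproducing kernel of the sub-Bergman space -/

section DefectSpace

variable {H : Type*} [NormedAddCommGroup H] [InnerProductSpace ℂ H] [CompleteSpace H]

theorem one_sub_mul_star_nonneg {T : H →L[ℂ] H} (hT : ‖T‖ ≤ 1) : 0 ≤ 1 - T * star T := by
  rw [ContinuousLinearMap.nonneg_iff_isPositive, ContinuousLinearMap.isPositive_def']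
  refine ⟨(IsSelfAdjoint.one _).sub (IsSelfAdjoint.mul_star_self T), fun x => ?_⟩
  have h1 : ‖star T x‖ ≤ ‖x‖ := by
    have := (star T).le_opNorm x
    rw [norm_star] at this
    nlinarith [norm_nonneg x]
  have h2 : ⟪T (star T x), x⟫_ℂ = ⟪star T x, star T x⟫_ℂ := by
    rw [ContinuousLinearMap.star_eq_adjoint, ContinuousLinearMap.adjoint_inner_right]
  rw [ContinuousLinearMap.reApplyInnerSelf_apply]
  change 0 ≤ RCLike.re ⟪x - T (star T x), x⟫_ℂ
  rw [inner_sub_left, h2, map_sub, inner_self_eq_norm_sq, inner_self_eq_norm_sq]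
  nlinarith [norm_nonneg x, norm_nonneg (star T x)]

theorem defectOp_isSelfAdjoint (T : H →L[ℂ] H) : IsSelfAdjoint (defectOp T) :=
  IsSelfAdjoint.of_nonneg (CFC.sqrt_nonneg _)

theorem defectOp_defectOp {T : H →L[ℂ] H} (hT : ‖T‖ ≤ 1) (x : H) :
    defectOp T (defectOp T x) = x - T (star T x) := by
  have h : defectOp T * defectOp T = 1 - T * star T :=
    CFC.sqrt_mul_sqrt_self _ (one_sub_mul_star_nonneg hT)
  exact congrArg (fun S : H →L[ℂ] H => S x) h

theorem inner_defectOp_left (T : H →L[ℂ] H) (x y : H) :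
    ⟪defectOp T x, y⟫_ℂ = ⟪x, defectOp T y⟫_ℂ := by
  have h := ContinuousLinearMap.adjoint_inner_left (defectOp T) y x
  rwa [← ContinuousLinearMap.star_eq_adjoint, (defectOp_isSelfAdjoint T).star_eq] at h

/-- D is self-adjoint, so its range is orthogonal to its kernel. -/
theorem defectOp_mem_orthogonal (T : H →L[ℂ] H) (x : H) : defectOp T x ∈ (defectOp T).kerᗮ := by
  intro y hy
  have hy0 : defectOp T y = 0 := hy
  rw [← inner_defectOp_left, hy0, inner_zero_left]

/-- The reproducing kernel of `H(T)` is the function of `(I - T T*) k_w`. -/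
theorem scalarKernel_defectSpace {X : Type*} [RKHS ℂ H X ℂ] {T : H →L[ℂ] H} (hT : ‖T‖ ≤ 1) {w : X}
    {k : H} (hk : ∀ f : H, ⟪k, f⟫_ℂ = f w) (z : X) :
    scalarKernel (DefectSpace T) z w = k z - T (star T k) z := by
  -- The model element Dk stands for the vector D(Dk) = (I - TT*)k. It represents evaluation at w,
  -- because self-adjointness moves D onto the other argument.
  let κ : DefectSpace T := (⟨defectOp T k, defectOp_mem_orthogonal T k⟩ : ↥((defectOp T).kerᗮ))
  have h1 : ∀ f : DefectSpace T, ⟪κ, f⟫_ℂ = f w := by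
    intro f
    have h2 : ⟪κ, f⟫_ℂ = ⟪defectOp T k, f.1⟫_ℂ := rfl
    rw [h2, inner_defectOp_left, hk]
    rfl
  rw [scalarKernel_eq_of_inner_eq h1 z]
  have h3 : κ z = (defectOp T (defectOp T k)) z := rfl
  rw [h3, defectOp_defectOp hT, RKHS.coe_sub]
  rfl

end DefectSpace

theorem norm_mulOp_le (α : ℝ) (hα : -1 < α) (φ : ℂ → ℂ) (hφ : DifferentiableOn ℂ φ (ball 0 1))
    (hb : ∀ z ∈ ball (0 : ℂ) 1, ‖φ z‖ ≤ 1) : ‖mulOp α hα φ hφ hb‖ ≤ 1 :=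
  LinearMap.mkContinuous_norm_le _ zero_le_one _

/-- Pairing with f evaluates φf at w, which is φ(w) times the evaluation of f. -/
theorem star_mulOp_bergmanKernelVec (α : ℝ) (hα : -1 < α) (φ : ℂ → ℂ)
    (hφ : DifferentiableOn ℂ φ (ball 0 1)) (hb : ∀ z ∈ ball (0 : ℂ) 1, ‖φ z‖ ≤ 1) (w : 𝔻) :
    star (mulOp α hα φ hφ hb) (bergmanKernelVec α hα w) =
      conj (φ w) • bergmanKernelVec α hα w := by
  refine ext_inner_right ℂ fun f => ?_
  rw [ContinuousLinearMap.star_eq_adjoint, ContinuousLinearMap.adjoint_inner_left,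
    inner_bergmanKernelVec, mulOp_apply]
  refine Eq.trans ?_ (inner_smul_left (bergmanKernelVec α hα w) f (conj (φ w))).symm
  rw [inner_bergmanKernelVec, conj_conj]

theorem scalarKernel_subBergman (α : ℝ) (hα : -1 < α) (φ : ℂ → ℂ)
    (hφ : DifferentiableOn ℂ φ (ball 0 1)) (hb : ∀ z ∈ ball (0 : ℂ) 1, ‖φ z‖ ≤ 1) (z w : 𝔻) :
    scalarKernel (SubBergman α hα φ hφ hb) z w =
      (1 - φ z * conj (φ w)) / (1 - (z : ℂ) * conj (w : ℂ)) ^ ((2 + α : ℝ) : ℂ) := by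
  have h : (conj (φ w) • bergmanKernelVec α hα w) z = conj (φ w) * bergmanKernelVec α hα w z :=
    congrFun (RKHS.coe_smul (bergmanKernelVec α hα w) (conj (φ w))) z
  rw [scalarKernel_defectSpace (norm_mulOp_le α hα φ hφ hb) (inner_bergmanKernelVec hα w),
    star_mulOp_bergmanKernelVec, mulOp_apply, h, bergmanKernelVec_apply,
    bergmanKernelFun]
  ring

end

theorem theorem5 (α : ℝ) (hα : -1 < α) (hα0 : α ≤ 0) (φ : ℂ → ℂ)
    (hφ : DifferentiableOn ℂ φ (ball 0 1)) (hb : ∀ z ∈ ball (0 : ℂ) 1, ‖φ z‖ ≤ 1) :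
    (∀ z w : 𝔻, scalarKernel (SubBergman α hα φ hφ hb) z w =
      (1 - φ z * conj (φ w)) / (1 - (z : ℂ) * conj (w : ℂ)) ^ ((2 + α : ℝ) : ℂ)) ∧
    (IsCNPKernel (scalarKernel (SubBergman α hα φ hφ hb)) ↔ IsMobius φ) := by
  have hK := scalarKernel_subBergman α hα φ hφ hb
  -- The bounds -1 < α ≤ 0 say both that 1 < 2 + α ≤ 2, as rigidity needs, and that 0 < 1 + α ≤ 1,
  -- as the nonnegative coefficients need.
  refine ⟨hK, fun h => isMobius_of_isCNPKernel (by linarith) (by linarith) hφ hb hK h, fun h =>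
    isCNPKernel_of_isMobius (s := 1 + α) (by linarith) (by linarith) h
      isKernelFunction_scalarKernel fun z w => ?_⟩
  rw [hK, ← add_assoc, one_add_one_eq_two]
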